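/- **Setting.** For each sample size $n$ let $p=p_n$ features be partitioned into $D=D_n$ blocks, where $p_n\to\infty$ as $n\to\infty$. Let $\Sigma$ be a $p\times p$ covariance matrix with $\Sigma_{jj}=1$ for all $j$, and let $\Lambda$ be its block-diagonal part (the entries $\Sigma_{ij}$ with $i,j$ in the same block, and $0$ elsewhere). For $j=1,\dots,p$ let $\xi_j$ maximize $\beta^\top\Sigma\beta/\beta^\top\Lambda\beta$ over all $\beta\in\mathbb R^p$ with $\|\beta\|_2=1$ and $\beta^\top\Lambda\xi_i=0$ for all $i<j$, and let $\rho_j=\xi_j^\top\Sigma\xi_j/\xi_j^\top\Lambda\xi_j$. Let $s=\|\xi_1\|_0$ be the number of nonzero entries of $\xi_1$. Assume that, for constants $M,\gamma,C>0$ and all $n$: 1. every eigenvalue of every diagonal block of $\Lambda$ lies in $[1/M,M]$; 2. $\rho_1\ge 1+C$ and $\rho_1-\rho_2\ge\gamma\rho_1$; 3. $s\ln p/n\to0$ as $n\to\infty$. The data are $n$ independent observations $x_1,\dots,x_n\sim\mathcal N(0,\Sigma)$. Let $\hat\Sigma=\frac1n\sum_i x_ix_i^\top$, let $\hat\Lambda$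 be the block-diagonal part of $\hat\Sigma$, and let $f(\beta)=\beta^\top\hat\Sigma\beta/\beta^\top\hat\Lambda\beta$. **Iterates.** Let $0<c_0<1$, $0<\eta\le\frac{1-c_0}{2M(M+3)}$ and $c_{B_1},c_{B_2}>0$ be constants, and let $1\le L_\infty\le\|\xi_1\|_1$ ($L_\infty$ may depend on $n$). Put $L_0=(1+c_{B_1})\sqrt s$ and $L_t=L_\infty+\bigl(1-c_{B_2}\eta\sqrt{s\ln p/n}\bigr)^t(L_0-L_\infty)$. From an initial guess $\beta_0$, which may depend on the data, let, for all large $n$ and all $t\ge0$, $\beta_{t+1}$ be a minimizer of $\|\beta-\theta_t\|_2^2$ over $\{\beta:\|\beta\|_2=1,\ \|\beta\|_1\le L_{t+1}\}$, where $\theta_t=\beta_t+\frac{\eta}{f(\beta_t)}\bigl(\hat\Sigma-f(\beta_t)\hat\Lambda\bigr)\beta_t$. Write $\delta_t=1-|\beta_t^\top\xi_1|$, $\nu=(1-c_0)\gamma^2/M$ and $$T^*=\max\Bigl\{t:\ L_t-\|\xi_1\|_1\ge\tfrac{4c_{B_2}(1+c_{B_1})}{\nu}\sqrt{s^2\ln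 p/n}\Bigr\}.$$ For $c_2,\tau>0$ define the penalized objective $$\underline f_\tau(\beta)=f(\beta)-\tau\rho_1\sqrt{\tfrac{\ln p}{n}}\Bigl(\|\beta\|_1+\frac{c_2\|\beta\|_1^2}{L_0}\Bigr).$$ **Theorem.** There is a constant $\psi_1>0$, depending only on $(M,\gamma,c_0,\eta,c_{B_1},c_{B_2})$, such that for every constant $c_2>0$ there is a constant $\tau_0>0$, depending only on these constants and $c_2$, such that for every $\tau\ge\tau_0$ there is a constant $\psi_2>0$, depending only on these constants, $c_2$ and $\tau$, with the following property. If the initial guess satisfies $\|\beta_0\|_2=1$, $\|\beta_0\|_1\le L_0$ and $\delta_0\le\psi_1$ with probability tending to $1$, then $$\lim_{n\to\infty}\mathbf P\Bigl(\delta_{t^*}\le\psi_2\,\frac{s\ln p}{n}\Bigr)=1,$$ where $t^*$ is any maximizer of $t\mapsto\underline f_\tau(\beta_t)$ over all iterations $t\ge0$ (if one exists), or over the iterations $0\le t\le N$ of a run stopped at any $N\ge T^*$; the probability is that the bound holds simultaneously for all these maximizers $t^*$. -/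

import Mathlib

open MeasureTheory ProbabilityTheory Filter Topology

namespace MsCCA

noncomputable section

/-- Column vectors of length `p`, with the Euclidean norm. -/
abbrev Vec (p : ℕ) := EuclideanSpace ℝ (Fin p)

/-- The `ℓ₁` norm. -/
def l1 {p : ℕ} (b : Vec p) : ℝ := ∑ j, |b j|

/-- The number of nonzero entries. -/
def l0 {p : ℕ} (b : Vec p) : ℕ := (Finset.univ.filter fun j => b j ≠ 0).card

/-- The quadratic form `bᵀ S b`. -/
def quad {p : ℕ} (S : Matrix (Fin p) (Fin p) ℝ) (b : Vec p) : ℝ :=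
  b.ofLp ⬝ᵥ S.mulVec b.ofLp

/-- The generalized Rayleigh quotient `bᵀ S b / bᵀ L b`. -/
def rayleigh {p : ℕ} (S L : Matrix (Fin p) (Fin p) ℝ) (b : Vec p) : ℝ :=
  quad S b / quad L b

/-- The block-diagonal part of `S`, where feature `j` belongs to block `blk j`. -/
def blockPart {p D : ℕ} (blk : Fin p → Fin D) (S : Matrix (Fin p) (Fin p) ℝ) :
    Matrix (Fin p) (Fin p) ℝ :=
  Matrix.of fun i j => if blk i = blk j then S i j else 0

/-- The diagonal block of `S` of the features in block `d`. -/
def blockOf {p D : ℕ} (blk : Fin p → Fin D) (S : Matrix (Fin p) (Fin p) ℝ) (d : Fin D) :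
    Matrix {j : Fin p // blk j = d} {j : Fin p // blk j = d} ℝ :=
  S.submatrix Subtype.val Subtype.val

/-- Unit vectors `b` with `bᵀ L ξᵢ = 0` for `1 ≤ i < j`. -/
def admissible {p : ℕ} (L : Matrix (Fin p) (Fin p) ℝ) (ξ : ℕ → Vec p) (j : ℕ) : Set (Vec p) :=
  {b | ‖b‖ = 1 ∧ ∀ i ∈ Finset.Ico 1 j, b.ofLp ⬝ᵥ L.mulVec (ξ i).ofLp = 0}

/-- `ξ 1, …, ξ p` are successive maximizers of the Rayleigh quotient (indices start at `1`;
values of `ξ` at other indices are irrelevant). -/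
def IsDirections {p : ℕ} (S L : Matrix (Fin p) (Fin p) ℝ) (ξ : ℕ → Vec p) : Prop :=
  ∀ j ∈ Finset.Icc 1 p, ξ j ∈ admissible L ξ j ∧
    ∀ b ∈ admissible L ξ j, rayleigh S L b ≤ rayleigh S L (ξ j)

/-- The population canonical correlation coefficient `ρ_j` of the `j`-th direction. -/
def corr {p D : ℕ} (blk : Fin p → Fin D) (S : Matrix (Fin p) (Fin p) ℝ) (ξ : ℕ → Vec p)
    (j : ℕ) : ℝ :=
  rayleigh S (blockPart blk S) (ξ j)

/-- The assumptions on the population: standardized covariance matrix, within-block eigenvalues in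
`[1/M, M]`, directions `ξ`, `ρ₁ ≥ 1 + C` and `ρ₁ - ρ₂ ≥ γ ρ₁`. -/
structure IsPopulation {p D : ℕ} (blk : Fin p → Fin D) (S : Matrix (Fin p) (Fin p) ℝ)
    (ξ : ℕ → Vec p) (M γ C : ℝ) : Prop where
  posSemidef : S.PosSemidef
  diag_eq_one : ∀ j, S j j = 1
  block_spectrum : ∀ d, spectrum ℝ (blockOf blk S d) ⊆ Set.Icc (1 / M) M
  directions : IsDirections S (blockPart blk S) ξ
  leading : 1 + C ≤ corr blk S ξ 1
  gap : γ * corr blk S ξ 1 ≤ corr blk S ξ 1 - corr blk S ξ 2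

/-- The empirical covariance matrix `Xᵀ X / n` of mean-zero data. -/
def sampleCov {n p : ℕ} (x : Fin n → Vec p) : Matrix (Fin p) (Fin p) ℝ :=
  Matrix.of fun j k => (∑ i, x i j * x i k) / n

/-- The empirical objective `f(b)`. -/
def objective {n p D : ℕ} (blk : Fin p → Fin D) (x : Fin n → Vec p) (b : Vec p) : ℝ :=
  rayleigh (sampleCov x) (blockPart blk (sampleCov x)) b

/-- The proximal target `θ = b + (η / f(b)) (Σ̂ - f(b) Λ̂) b`. -/
def proxTarget {n p D : ℕ} (blk : Fin p → Fin D) (x : Fin n → Vec p) (η : ℝ) (b : Vec p) :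
    Vec p :=
  b + (η / objective blk x b) •
    WithLp.toLp 2 ((sampleCov x - objective blk x b • blockPart blk (sampleCov x)).mulVec b.ofLp)

/-- Unit vectors of `ℓ₁` norm at most `L`. -/
def feasible (p : ℕ) (L : ℝ) : Set (Vec p) := {b | ‖b‖ = 1 ∧ l1 b ≤ L}

/-- `b` is a sequence of iterates with step size `η` and `ℓ₁` bounds `L`: each `b (t + 1)` is a
(not necessarily unique) point of `feasible p (L (t + 1))` nearest to the proximal target. -/
def IsRun {n p D : ℕ} (blk : Fin p → Fin D) (x : Fin n → Vec p) (η : ℝ) (L : ℕ → ℝ)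
    (b : ℕ → Vec p) : Prop :=
  ∀ t, b (t + 1) ∈ feasible p (L (t + 1)) ∧
    ∀ v ∈ feasible p (L (t + 1)),
      ‖b (t + 1) - proxTarget blk x η (b t)‖ ^ 2 ≤ ‖v - proxTarget blk x η (b t)‖ ^ 2

/-- The rate `s ln p / n`. -/
def rate (s p n : ℕ) : ℝ := s * Real.log p / n

/-- The initial bound `L₀ = (1 + c_{B₁}) √s`. -/
def initBound (cB₁ : ℝ) (s : ℕ) : ℝ := (1 + cB₁) * √(s : ℝ)

/-- The bounds `L_t = L_∞ + (1 - c_{B₂} η √(s ln p / n))ᵗ (L₀ - L_∞)`. -/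
def bound (cB₁ cB₂ η Linf : ℝ) (s p n t : ℕ) : ℝ :=
  Linf + (1 - cB₂ * η * √(rate s p n)) ^ t * (initBound cB₁ s - Linf)

/-- The iteration `T* = max {t : L_t - ‖ξ₁‖₁ ≥ (4 c_{B₂} (1 + c_{B₁}) / ν) √(s² ln p / n)}` with
`ν = (1 - c₀) γ² / M`, where `ℓ = ‖ξ₁‖₁`. When `s ln p / n` is small and positive and `L_∞ ≤ ℓ ≤ √s`,
the set is nonempty and finite, so that the supremum in `ℕ` is a maximum. -/
def lastIter (M γ c₀ cB₁ cB₂ η Linf ℓ : ℝ) (s p n : ℕ) : ℕ :=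
  sSup {t : ℕ | 4 * cB₂ * (1 + cB₁) / ((1 - c₀) * γ ^ 2 / M) *
      √((s : ℝ) ^ 2 * Real.log p / n) ≤ bound cB₁ cB₂ η Linf s p n t - ℓ}

/-- The penalized objective `f(b) - τ ρ₁ √(ln p / n) (‖b‖₁ + c₂ ‖b‖₁² / L₀)`. -/
def penalized {n p D : ℕ} (blk : Fin p → Fin D) (x : Fin n → Vec p) (τ ρ₁ c₂ L₀ : ℝ)
    (b : Vec p) : ℝ :=
  objective blk x b - τ * ρ₁ * √(Real.log p / n) * (l1 b + c₂ * l1 b ^ 2 / L₀)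

/-- The discrepancy `δ = 1 - |bᵀ ξ₁|`. -/
def discrepancy {p : ℕ} (ξ₁ b : Vec p) : ℝ := 1 - |inner ℝ b ξ₁|

end

end MsCCA

namespace MsCCA

noncomputable section

/-! With high probability the forms of the sample covariance and of its block part are within
relative error e = O(√(s ln p / n)) of the population forms, measured in the norm ‖u‖₂ + ‖u‖₁/√s
(`IsClose`). This follows from a chi-square tail bound and a union bound over a grid
(`measure_net_deviation_le`), which passes to all 2s-sparse vectors (`abs_quad_le_of_net`) and then,
by peeling off s coordinates at a time, to all vectors (`abs_bil_le_mixedNorm`). The rest is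
deterministic.

Let x be ξ₁ or −ξ₁, whichever is nearer to β₀, and let y_t = (L_t − ‖x‖₁)/√s be the normalized
slack. Up to errors of order ‖β_t − x‖² + e, the gradient step is the linear map 1 + η(Σ/ρ₁ − Λ),
which fixes x and, by the eigengap, contracts differences b − x of nearby unit vectors. A nearest
feasible point maximizes v ↦ ⟨v, θ⟩; as long as there is slack it can be compared with the
normalized points of the segment towards x, although the sphere is not convex
(`interpolation_bound`). Hence one step multiplies ‖β_t − x‖² by at most 1 − κ/2, with κ = ηγ/(2M),
up to O(e² + e·y_{t+1}) (`IsLeading.step`). The bounds shrink slowly: a step lowers y by O(e) only.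
So ‖β_t − x‖² ≤ c·y_t² persists as long as y_t ≥ K₁e (`exists_run_constants`). At the last iteration
T before y first falls below K₁e, the slack is O(e); thus β_T is within O(e) of x with ℓ₁ excess
O(e√s), and T ≤ T*.

Nothing is claimed about the later iterates themselves. The selected one has a penalized objective
at least that of β_T, and the basic inequality of the lasso applies: the curvature of the Rayleigh
quotient at x controls the distance, while the noise due to an ℓ₁ excess is paid for by the penalty
(`exists_penalized_constants`). This gives δ = O(e²). The constants are assembled in
`exists_deterministic_constants`. -/

/-- The bilinear form `uᵀ S v`. -/
def bil {p : ℕ} (S : Matrix (Fin p) (Fin p) ℝ) (u v : Vec p) : ℝ :=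
  u.ofLp ⬝ᵥ S.mulVec v.ofLp

/-! ### Bilinear forms: Cauchy–Schwarz and polarization. -/

section Bilinear

variable {p : ℕ} (S T : Matrix (Fin p) (Fin p) ℝ) (u v w : Vec p) (c : ℝ)

lemma quad_eq_bil : quad S u = bil S u u := rfl

lemma bil_eq_sum : bil S u v = ∑ i, ∑ j, u i * S i j * v j := by
  simp [bil, dotProduct, Matrix.mulVec, Finset.mul_sum, mul_assoc]

@[simp] lemma bil_add_left : bil S (u + v) w = bil S u w + bil S v w := by
  simp [bil, add_dotProduct]

@[simp] lemma bil_add_right : bil S u (v + w) = bil S u v + bil S u w := by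
  simp [bil, Matrix.mulVec_add, dotProduct_add]

@[simp] lemma bil_sub_left : bil S (u - v) w = bil S u w - bil S v w := by
  simp [bil, sub_dotProduct]

@[simp] lemma bil_sub_right : bil S u (v - w) = bil S u v - bil S u w := by
  simp [bil, Matrix.mulVec_sub, dotProduct_sub]

@[simp] lemma bil_smul_left : bil S (c • u) v = c * bil S u v := by
  simp [bil, smul_dotProduct]

@[simp] lemma bil_smul_right : bil S u (c • v) = c * bil S u v := by
  simp [bil, Matrix.mulVec_smul, dotProduct_smul]

@[simp] lemma bil_neg_left : bil S (-u) v = -bil S u v := by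
  simp [bil, neg_dotProduct]

@[simp] lemma bil_neg_right : bil S u (-v) = -bil S u v := by
  simp [bil, Matrix.mulVec_neg, dotProduct_neg]

@[simp] lemma bil_zero_left : bil S 0 v = 0 := by simp [bil]

@[simp] lemma bil_zero_right : bil S v 0 = 0 := by simp [bil]

@[simp] lemma bil_matrix_add : bil (S + T) u v = bil S u v + bil T u v := by
  simp [bil, Matrix.add_mulVec, dotProduct_add]

@[simp] lemma bil_matrix_sub : bil (S - T) u v = bil S u v - bil T u v := by
  simp [bil, Matrix.sub_mulVec, dotProduct_sub]

@[simp] lemma bil_matrix_smul : bil (c • S) u v = c * bil S u v := by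
  simp [bil, Matrix.smul_mulVec, dotProduct_smul]

@[simp] lemma bil_one : bil 1 u v = inner ℝ u v := by
  simp [bil, PiLp.inner_apply, dotProduct, mul_comm]

lemma inner_toLp_mulVec : inner ℝ u (WithLp.toLp 2 (S.mulVec v.ofLp)) = bil S u v := by
  simp [bil, PiLp.inner_apply, dotProduct, mul_comm]

variable {S u v w c}

lemma bil_comm (hS : S.IsSymm) : bil S u v = bil S v u := by
  rw [bil_eq_sum, bil_eq_sum, Finset.sum_comm]
  refine Finset.sum_congr rfl fun i _ => Finset.sum_congr rfl fun j _ => ?_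
  rw [hS.apply i j]; ring

/-- The quadratic polynomial t ↦ S(tu + v, tu + v) is nonnegative, so its discriminant is not
positive. -/
lemma sq_bil_le (hS : S.IsSymm) (h0 : ∀ u : Vec p, 0 ≤ bil S u u) (u v : Vec p) :
    bil S u v ^ 2 ≤ bil S u u * bil S v v := by
  have h : ∀ t : ℝ, 0 ≤ bil S u u * (t * t) + 2 * bil S u v * t + bil S v v := by
    intro t
    have := h0 (t • u + v)
    simp only [bil_add_left, bil_add_right, bil_smul_left, bil_smul_right,
      bil_comm hS (u := v) (v := u)] at this
    linarith
  have := discrim_le_zero h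
  unfold discrim at this
  nlinarith

lemma abs_bil_le_of_quad_le (hS : S.IsSymm) (h0 : ∀ u : Vec p, 0 ≤ bil S u u) {a U V : ℝ}
    (ha : 0 ≤ a) (hU : 0 ≤ U) (hV : 0 ≤ V) (hu : bil S u u ≤ a * U ^ 2)
    (hv : bil S v v ≤ a * V ^ 2) : |bil S u v| ≤ a * (U * V) := by
  apply abs_le_of_sq_le_sq _ (by positivity)
  calc bil S u v ^ 2 ≤ bil S u u * bil S v v := sq_bil_le hS h0 u v
    _ ≤ (a * U ^ 2) * (a * V ^ 2) := mul_le_mul hu hv (h0 v) (by positivity)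
    _ = _ := by ring

/-- Polarization: a symmetric form bounded on the diagonal of a subspace is bounded on it. -/
lemma abs_bil_le_of_abs_quad_le (hS : S.IsSymm) {a : ℝ} (P : Submodule ℝ (Vec p))
    (h : ∀ u ∈ P, |bil S u u| ≤ a * ‖u‖ ^ 2) (hu : u ∈ P) (hv : v ∈ P) :
    |bil S u v| ≤ a * (‖u‖ * ‖v‖) := by
  have key : ∀ x ∈ P, ∀ y ∈ P, ‖x‖ = 1 → ‖y‖ = 1 → |bil S x y| ≤ a := by
    intro x hx y hy hx1 hy1
    have h1 := abs_le.1 (h _ (P.add_mem hx hy))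
    have h2 := abs_le.1 (h _ (P.sub_mem hx hy))
    -- 4 S(x, y) = S(x + y, x + y) − S(x − y, x − y), and ‖x + y‖² + ‖x − y‖² = 4, so no constant is
    -- lost.
    have e := parallelogram_law_with_norm ℝ x y
    simp only [bil_add_left, bil_add_right, bil_sub_left, bil_sub_right,
      bil_comm hS (u := y) (v := x)] at h1 h2
    rw [hx1, hy1] at e
    rw [abs_le]
    constructor <;> nlinarith
  rcases eq_or_ne u 0 with rfl | hu0
  · simp
  rcases eq_or_ne v 0 with rfl | hv0
  · simp
  have hun : 0 < ‖u‖ := norm_pos_iff.2 hu0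
  have hvn : 0 < ‖v‖ := norm_pos_iff.2 hv0
  have := key (‖u‖⁻¹ • u) (P.smul_mem _ hu) (‖v‖⁻¹ • v) (P.smul_mem _ hv)
    (by rw [norm_smul, norm_inv, norm_norm, inv_mul_cancel₀ hun.ne'])
    (by rw [norm_smul, norm_inv, norm_norm, inv_mul_cancel₀ hvn.ne'])
  rw [bil_smul_left, bil_smul_right, abs_mul, abs_mul, abs_of_pos (inv_pos.2 hun),
    abs_of_pos (inv_pos.2 hvn)] at this
  calc |bil S u v| = (‖u‖⁻¹ * (‖v‖⁻¹ * |bil S u v|)) * (‖u‖ * ‖v‖) := by field_simp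
    _ ≤ a * (‖u‖ * ‖v‖) := by gcongr

end Bilinear

/-! ### The leading generalized eigenvector and the curvature around it. -/

/-- `x` is a unit vector spanning the leading generalized eigenspace of `(S, L)`, with eigenvalue
`r` and relative eigengap `γ`, where `L` has its eigenvalues in `[1 / M, M]`. -/
structure IsLeading {p : ℕ} (S L : Matrix (Fin p) (Fin p) ℝ) (x : Vec p) (r M γ : ℝ) : Prop where
  symm_left : S.IsSymm
  symm_right : L.IsSymm
  nonneg : ∀ u : Vec p, 0 ≤ bil S u u
  lower : ∀ u : Vec p, ‖u‖ ^ 2 ≤ M * bil L u u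
  upper : ∀ u : Vec p, bil L u u ≤ M * ‖u‖ ^ 2
  norm_eq : ‖x‖ = 1
  pos : 0 < r
  eigen : ∀ v : Vec p, bil S v x = r * bil L v x
  gap : ∀ w : Vec p, bil L w x = 0 → bil S w w ≤ (1 - γ) * r * bil L w w

namespace IsLeading

variable {p : ℕ} {S L : Matrix (Fin p) (Fin p) ℝ} {x : Vec p} {r M γ : ℝ}

lemma neg (h : IsLeading S L x r M γ) : IsLeading S L (-x) r M γ where
  symm_left := h.symm_left
  symm_right := h.symm_right
  nonneg := h.nonneg
  lower := h.lower
  upper := h.upper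
  norm_eq := by rw [norm_neg, h.norm_eq]
  pos := h.pos
  eigen v := by simp [h.eigen]
  gap w hw := h.gap w (by simpa using hw)

lemma one_le (h : IsLeading S L x r M γ) : 1 ≤ M * bil L x x := by
  simpa [h.norm_eq] using h.lower x

lemma nonneg_right (h : IsLeading S L x r M γ) (hM : 0 < M) (u : Vec p) : 0 ≤ bil L u u :=
  nonneg_of_mul_nonneg_right ((sq_nonneg _).trans (h.lower u)) hM

/-- Splitting off the leading direction only loses the `L`-orthogonal part. -/
lemma exists_orthogonal (h : IsLeading S L x r M γ) (hM : 0 < M) (u : Vec p) : ∃ a : ℝ,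
    γ * r * bil L (u - a • x) (u - a • x) ≤ r * bil L u u - bil S u u := by
  have hx : 0 < bil L x x := by
    have := h.one_le
    by_contra hc
    nlinarith
  set a := bil L u x / bil L x x with ha
  refine ⟨a, ?_⟩
  have hw : bil L (u - a • x) x = 0 := by
    rw [bil_sub_left, bil_smul_left, ha, div_mul_cancel₀ _ hx.ne', sub_self]
  have hg := h.gap _ hw
  have e1 : bil S (u - a • x) (u - a • x) =
      bil S u u - 2 * a * bil S u x + a ^ 2 * bil S x x := by
    simp only [bil_sub_left, bil_sub_right, bil_smul_left, bil_smul_right,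
      bil_comm h.symm_left (u := x) (v := u)]
    ring
  have e2 : bil L (u - a • x) (u - a • x) =
      bil L u u - 2 * a * bil L u x + a ^ 2 * bil L x x := by
    simp only [bil_sub_left, bil_sub_right, bil_smul_left, bil_smul_right,
      bil_comm h.symm_right (u := x) (v := u)]
    ring
  rw [h.eigen u, h.eigen x] at e1
  -- The form r L − S has `x` in its kernel, so it does not see the multiple `a • x`.
  have e3 : r * bil L u u - bil S u u =
      r * bil L (u - a • x) (u - a • x) - bil S (u - a • x) (u - a • x) := by
    rw [e1, e2]; ring
  rw [e3]
  linarith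

lemma le_top (h : IsLeading S L x r M γ) (hM : 0 < M) (hγ : 0 ≤ γ) (u : Vec p) :
    bil S u u ≤ r * bil L u u := by
  obtain ⟨a, ha⟩ := h.exists_orthogonal hM u
  have := mul_nonneg (mul_nonneg hγ h.pos.le) (h.nonneg_right hM (u - a • x))
  linarith

lemma le_norm (h : IsLeading S L x r M γ) (hM : 0 < M) (hγ : 0 ≤ γ) (u : Vec p) :
    bil S u u ≤ r * M * ‖u‖ ^ 2 :=
  (h.le_top hM hγ u).trans (by nlinarith [h.upper u, h.pos])

lemma abs_left_le (h : IsLeading S L x r M γ) (hM : 0 < M) (hγ : 0 ≤ γ) (u v : Vec p) :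
    |bil S u v| ≤ r * M * (‖u‖ * ‖v‖) :=
  abs_bil_le_of_quad_le h.symm_left h.nonneg (mul_nonneg h.pos.le hM.le) (norm_nonneg _)
    (norm_nonneg _) (h.le_norm hM hγ u) (h.le_norm hM hγ v)

lemma abs_right_le (h : IsLeading S L x r M γ) (hM : 0 < M) (u v : Vec p) :
    |bil L u v| ≤ M * (‖u‖ * ‖v‖) :=
  abs_bil_le_of_quad_le h.symm_right (h.nonneg_right hM) hM.le (norm_nonneg _)
    (norm_nonneg _) (h.upper u) (h.upper v)

lemma inner_sub_self {b x : Vec p} (hb : ‖b‖ = 1) (hx : ‖x‖ = 1) :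
    inner ℝ (b - x) x = -‖b - x‖ ^ 2 / 2 := by
  have h1 := norm_sub_sq_real b x
  rw [inner_sub_left, real_inner_self_eq_norm_sq, h1, hb, hx]
  ring

/-- Since ⟨b − x, x⟩ = −‖b − x‖²/2, a difference of unit vectors keeps at least half of its squared
length when any multiple of `x` is removed; the gap applies to what remains. -/
lemma curvature (h : IsLeading S L x r M γ) (hM : 0 < M) (hγ : 0 ≤ γ) {b : Vec p} (hb : ‖b‖ = 1)
    (hbx : ‖b - x‖ ^ 2 ≤ 2) :
    γ / (2 * M) * r * ‖b - x‖ ^ 2 ≤ r * bil L (b - x) (b - x) - bil S (b - x) (b - x) := by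
  obtain ⟨a, ha⟩ := h.exists_orthogonal hM (b - x)
  refine le_trans ?_ ha
  have h1 := h.lower (b - x - a • x)
  have h2 : ‖b - x‖ ^ 2 / 2 ≤ ‖b - x - a • x‖ ^ 2 := by
    rw [norm_sub_sq_real (b - x) (a • x), inner_smul_right, inner_sub_self hb h.norm_eq,
      norm_smul, h.norm_eq, mul_one, Real.norm_eq_abs, sq_abs]
    nlinarith [sq_nonneg (a + ‖b - x‖ ^ 2 / 2), sq_nonneg ‖b - x‖]
  have h3 : ‖b - x‖ ^ 2 / (2 * M) ≤ bil L (b - x - a • x) (b - x - a • x) := by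
    rw [div_le_iff₀ (by positivity)]
    linarith
  calc γ / (2 * M) * r * ‖b - x‖ ^ 2 = γ * r * (‖b - x‖ ^ 2 / (2 * M)) := by ring
    _ ≤ _ := mul_le_mul_of_nonneg_left h3 (mul_nonneg hγ h.pos.le)

end IsLeading

/-! ### The ℓ₁ norm, sparsity and the mixed norm. -/

section L1

variable {p : ℕ}

lemma l1_nonneg (u : Vec p) : 0 ≤ l1 u := Finset.sum_nonneg fun _ _ => abs_nonneg _

lemma l1_add_le (u v : Vec p) : l1 (u + v) ≤ l1 u + l1 v := by
  simp only [l1, ← Finset.sum_add_distrib]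
  exact Finset.sum_le_sum fun j _ => abs_add_le _ _

lemma l1_smul (c : ℝ) (u : Vec p) : l1 (c • u) = |c| * l1 u := by
  simp [l1, Finset.mul_sum, abs_mul]

@[simp] lemma l1_neg (u : Vec p) : l1 (-u) = l1 u := by simp [l1]

@[simp] lemma l0_neg (u : Vec p) : l0 (-u) = l0 u := by simp [l0]

lemma sum_abs_le (T : Finset (Fin p)) (u : Vec p) :
    ∑ j ∈ T, |u j| ≤ √(T.card : ℝ) * ‖u‖ := by
  have h1 : (∑ j ∈ T, |u j|) ^ 2 ≤ T.card * ∑ j ∈ T, |u j| ^ 2 := sq_sum_le_card_mul_sum_sq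
  have h2 : ∑ j ∈ T, |u j| ^ 2 ≤ ‖u‖ ^ 2 := by
    rw [EuclideanSpace.norm_sq_eq]
    simp only [Real.norm_eq_abs]
    exact Finset.sum_le_univ_sum_of_nonneg fun _ => sq_nonneg _
  apply le_of_sq_le_sq _ (by positivity)
  rw [mul_pow, Real.sq_sqrt (Nat.cast_nonneg _)]
  exact h1.trans (by gcongr)

lemma l1_le_sqrt_l0 (u : Vec p) : l1 u ≤ √(l0 u : ℝ) * ‖u‖ := by
  refine le_trans (le_of_eq ?_) (sum_abs_le (Finset.univ.filter fun j => u j ≠ 0) u)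
  rw [Finset.sum_filter, l1]
  refine Finset.sum_congr rfl fun j _ => ?_
  by_cases h : u j = 0 <;> simp [h]

/-- Off the support of `x` the entries of b − x are those of `b`. On the support the triangle
inequality costs twice the ℓ₁ norm of b − x there, which is at most √s ‖b − x‖. This is the cone
condition of the lasso, with the ℓ₁ excess as an additional term. -/
lemma l1_sub_le (b x : Vec p) :
    l1 (b - x) ≤ 2 * (√(l0 x : ℝ) * ‖b - x‖) + (l1 b - l1 x) := by
  have h := sum_abs_le (Finset.univ.filter fun j => x j ≠ 0) (b - x)
  refine le_trans ?_ (add_le_add_left (mul_le_mul_of_nonneg_left h zero_le_two) _)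
  rw [Finset.sum_filter, Finset.mul_sum]
  simp only [l1, ← Finset.sum_sub_distrib, ← Finset.sum_add_distrib]
  refine Finset.sum_le_sum fun j _ => ?_
  by_cases hj : x j = 0
  · simp [hj]
  · simp only [PiLp.sub_apply, ne_eq, hj, not_false_eq_true, if_true]
    have := abs_sub_abs_le_abs_sub (x j) (b j)
    rw [abs_sub_comm] at this
    linarith

lemma l1_sub_l1_le (b x : Vec p) : l1 x - l1 b ≤ √(l0 x : ℝ) * ‖b - x‖ := by
  have h := sum_abs_le (Finset.univ.filter fun j => x j ≠ 0) (b - x)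
  refine le_trans ?_ h
  rw [Finset.sum_filter]
  simp only [l1, ← Finset.sum_sub_distrib]
  refine Finset.sum_le_sum fun j _ => ?_
  by_cases hj : x j = 0
  · simp [hj]
  · simp only [PiLp.sub_apply, ne_eq, hj, not_false_eq_true, if_true]
    have := abs_sub_abs_le_abs_sub (x j) (b j)
    rwa [abs_sub_comm] at this

lemma l0_pos {x : Vec p} (hx : ‖x‖ = 1) : 0 < l0 x := by
  rw [l0, Finset.card_pos]
  by_contra hc
  rw [Finset.not_nonempty_iff_eq_empty, Finset.filter_eq_empty_iff] at hc
  have : x = 0 := by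
    ext j
    simpa using hc (Finset.mem_univ j)
  rw [this, norm_zero] at hx
  exact zero_ne_one hx

/-- The norm `‖u‖₂ + ‖u‖₁ / √s`. -/
def mixedNorm (s : ℕ) (u : Vec p) : ℝ := ‖u‖ + l1 u / √(s : ℝ)

lemma mixedNorm_nonneg (s : ℕ) (u : Vec p) : 0 ≤ mixedNorm s u :=
  add_nonneg (norm_nonneg _) (div_nonneg (l1_nonneg _) (Real.sqrt_nonneg _))

lemma mixedNorm_le {s : ℕ} (hs : 0 < s) {u : Vec p} {A : ℝ} (hu : ‖u‖ = 1)
    (h1 : l1 u ≤ A * √(s : ℝ)) : mixedNorm s u ≤ 1 + A := by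
  have : 0 < √(s : ℝ) := Real.sqrt_pos.2 (by exact_mod_cast hs)
  rw [mixedNorm, hu]
  gcongr
  rwa [div_le_iff₀ this]

lemma mixedNorm_sub_le {b x : Vec p} (hx : ‖x‖ = 1) :
    mixedNorm (l0 x) (b - x) ≤ 3 * ‖b - x‖ + (l1 b - l1 x) / √(l0 x : ℝ) := by
  have h0 : 0 < √(l0 x : ℝ) := Real.sqrt_pos.2 (by exact_mod_cast l0_pos hx)
  have := div_le_div_of_nonneg_right (l1_sub_le b x) h0.le
  rw [add_div, mul_div_assoc, mul_div_cancel_left₀ _ h0.ne'] at this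
  rw [mixedNorm]
  linarith

end L1

/-! ### Linearization of the empirical gradient step. -/

/-- The forms of `Sh`, `Lh` are within relative error `e` of those of `S`, `L` in the mixed norm. -/
structure IsClose {p : ℕ} (S L Sh Lh : Matrix (Fin p) (Fin p) ℝ) (s : ℕ) (r e : ℝ) : Prop where
  left : ∀ u v : Vec p, |bil Sh u v - bil S u v| ≤ r * (e * (mixedNorm s u * mixedNorm s v))
  right : ∀ u v : Vec p, |bil Lh u v - bil L u v| ≤ e * (mixedNorm s u * mixedNorm s v)

/-- The gradient step `b + (η / f(b)) (S - f(b) L) b`, where `f` is the Rayleigh quotient. -/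
def gradStep {p : ℕ} (S L : Matrix (Fin p) (Fin p) ℝ) (η : ℝ) (b : Vec p) : Vec p :=
  b + (η / rayleigh S L b) • WithLp.toLp 2 ((S - rayleigh S L b • L).mulVec b.ofLp)

section Step

variable {p : ℕ} {S L Sh Lh : Matrix (Fin p) (Fin p) ℝ} {x b β : Vec p} {r M γ e η N₀ : ℝ} {s : ℕ}

lemma inner_gradStep (v : Vec p) :
    inner ℝ v (gradStep S L η β) = inner ℝ v β +
      η / rayleigh S L β * (bil S v β - rayleigh S L β * bil L v β) := by
  rw [gradStep, inner_add_right, inner_smul_right, inner_toLp_mulVec, bil_matrix_sub,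
    bil_matrix_smul]

/-- `x` lies in the kernel of r L − S, so there is no linear term. This is why the Rayleigh quotient
is within O(‖b − x‖²) of its maximum. -/
lemma IsLeading.form_sub (h : IsLeading S L x r M γ) (b : Vec p) :
    r * bil L b b - bil S b b = r * bil L (b - x) (b - x) - bil S (b - x) (b - x) := by
  simp only [bil_sub_left, bil_sub_right, bil_comm h.symm_left (u := x) (v := b),
    bil_comm h.symm_right (u := x) (v := b), h.eigen]
  ring

lemma IsClose.quad_left (hc : IsClose S L Sh Lh s r e) (hr : 0 < r) (he : 0 ≤ e)
    (hN : mixedNorm s b ≤ N₀) : |bil Sh b b - bil S b b| ≤ r * (e * N₀ ^ 2) := by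
  refine (hc.left b b).trans ?_
  have := mixedNorm_nonneg s b
  rw [← pow_two]
  gcongr

lemma IsClose.quad_right (hc : IsClose S L Sh Lh s r e) (he : 0 ≤ e)
    (hN : mixedNorm s b ≤ N₀) : |bil Lh b b - bil L b b| ≤ e * N₀ ^ 2 := by
  refine (hc.right b b).trans ?_
  have := mixedNorm_nonneg s b
  rw [← pow_two]
  gcongr

/-- The numerator of r / f − 1 is quadratic in b − x up to noise by `IsLeading.form_sub`; the
smallness condition keeps the denominator at least r / (2 M). -/
lemma IsLeading.rayleigh_close (h : IsLeading S L x r M γ) (hc : IsClose S L Sh Lh s r e)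
    (hM : 0 < M) (hγ : 0 ≤ γ) (he : 0 ≤ e) (hb : ‖b‖ = 1) (hN : mixedNorm s b ≤ N₀)
    (hsmall : M * ‖b - x‖ ^ 2 + 2 * N₀ ^ 2 * e ≤ 1 / (2 * M)) :
    0 < rayleigh Sh Lh b ∧
      |r / rayleigh Sh Lh b - 1| ≤ 2 * M * (M * ‖b - x‖ ^ 2 + 2 * N₀ ^ 2 * e) := by
  have hr := h.pos
  have h1 := abs_le.1 (hc.quad_left hr he hN)
  have h2 := abs_le.1 (hc.quad_right he hN)
  have h3 := h.form_sub b
  have h4 := h.le_top hM hγ (b - x)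
  have h5 := h.nonneg (b - x)
  have h6 := h.upper (b - x)
  have h7 := h.lower b
  have hN2 : 0 ≤ N₀ ^ 2 * e := by positivity
  have hinv : 0 < 1 / (2 * M) := by positivity
  rw [hb] at h7
  have h7' : 2 * (1 / (2 * M)) ≤ bil L b b := by
    rw [← mul_div_assoc, div_le_iff₀ (by positivity)]
    linarith
  have hd : 0 ≤ r * bil L b b - bil S b b := by rw [h3]; linarith
  have hd' : r * bil L b b - bil S b b ≤ r * (M * ‖b - x‖ ^ 2) := by
    rw [h3]
    nlinarith
  have hG : 0 ≤ M * ‖b - x‖ ^ 2 := by positivity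
  have hLh : 0 < bil Lh b b := by linarith
  have hSh : r * (1 / (2 * M)) ≤ bil Sh b b := by
    have : r * (2 * (1 / (2 * M))) ≤ r * bil L b b := by gcongr
    have : r * (M * ‖b - x‖ ^ 2 + 2 * N₀ ^ 2 * e) ≤ r * (1 / (2 * M)) := by gcongr
    nlinarith
  have hSh0 : 0 < bil Sh b b := lt_of_lt_of_le (by positivity) hSh
  rw [rayleigh, quad_eq_bil, quad_eq_bil]
  refine ⟨by positivity, ?_⟩
  have e1 : r / (bil Sh b b / bil Lh b b) - 1 = (r * bil Lh b b - bil Sh b b) / bil Sh b b := by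
    field_simp
  rw [e1, abs_div, abs_of_pos hSh0, div_le_iff₀ hSh0]
  have e2 : |r * bil Lh b b - bil Sh b b| ≤ r * (M * ‖b - x‖ ^ 2 + 2 * N₀ ^ 2 * e) := by
    rw [abs_le]
    constructor <;> nlinarith
  refine e2.trans ?_
  calc r * (M * ‖b - x‖ ^ 2 + 2 * N₀ ^ 2 * e)
      = 2 * M * (M * ‖b - x‖ ^ 2 + 2 * N₀ ^ 2 * e) * (r * (1 / (2 * M))) := by field_simp
    _ ≤ _ := by gcongr

/-- The empirical gradient step is close to the linear map `1 + η (S / r - L)`. -/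
lemma IsLeading.abs_inner_gradStep_sub_le (h : IsLeading S L x r M γ)
    (hc : IsClose S L Sh Lh s r e) (hM : 0 < M) (hγ : 0 ≤ γ) (he : 0 ≤ e) (hη : 0 < η)
    (hb : ‖b‖ = 1) (hN : mixedNorm s b ≤ N₀)
    (hsmall : M * ‖b - x‖ ^ 2 + 2 * N₀ ^ 2 * e ≤ 1 / (2 * M)) (v : Vec p) :
    |inner ℝ v (gradStep Sh Lh η b) - (inner ℝ v b + η * (bil S v b / r - bil L v b))| ≤
      η * (2 * M * (M * ‖b - x‖ ^ 2 + 2 * N₀ ^ 2 * e) * M * ‖v‖ +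
        3 * e * N₀ * mixedNorm s v) := by
  have hr := h.pos
  obtain ⟨hf, hφ⟩ := h.rayleigh_close hc hM hγ he hb hN hsmall
  set φ₀ := 2 * M * (M * ‖b - x‖ ^ 2 + 2 * N₀ ^ 2 * e) with hφ₀
  set f := rayleigh Sh Lh b with hf'
  have hφ1 : φ₀ ≤ 1 := by
    calc φ₀ ≤ 2 * M * (1 / (2 * M)) := by rw [hφ₀]; gcongr
      _ = 1 := by field_simp
  have hSv := h.abs_left_le hM hγ v b
  rw [hb, mul_one] at hSv
  have h1 := hc.left v b
  have h2 := hc.right v b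
  have hv0 := mixedNorm_nonneg s v
  have hN' : mixedNorm s v * mixedNorm s b ≤ mixedNorm s v * N₀ := by gcongr
  have h1' : |(bil Sh v b - bil S v b) / r| ≤ e * (mixedNorm s v * N₀) := by
    rw [abs_div, abs_of_pos hr, div_le_iff₀ hr]
    refine h1.trans ?_
    rw [mul_comm r]
    gcongr
  have h2' : |bil Lh v b - bil L v b| ≤ e * (mixedNorm s v * N₀) := h2.trans (by gcongr)
  have hSv' : |bil S v b / r| ≤ M * ‖v‖ := by
    rw [abs_div, abs_of_pos hr, div_le_iff₀ hr]
    linarith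
  have hφ2 : |r / f| ≤ 2 := by
    have := abs_le.1 hφ
    rw [abs_le]; constructor <;> linarith
  -- Three sources of error: the estimated eigenvalue, the deviation of `Sh` and the deviation of
  -- `Lh`.
  have key : inner ℝ v (gradStep Sh Lh η b) - (inner ℝ v b + η * (bil S v b / r - bil L v b)) =
      η * ((r / f - 1) * (bil S v b / r) + r / f * ((bil Sh v b - bil S v b) / r)
        - (bil Lh v b - bil L v b)) := by
    rw [inner_gradStep, ← hf']
    field_simp
    ring
  rw [key, abs_mul, abs_of_pos hη]
  gcongr
  have a1 : |(r / f - 1) * (bil S v b / r)| ≤ φ₀ * (M * ‖v‖) := by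
    rw [abs_mul]; gcongr
  have a2 : |r / f * ((bil Sh v b - bil S v b) / r)| ≤ 2 * (e * (mixedNorm s v * N₀)) := by
    rw [abs_mul]; gcongr
  have a3 := abs_le.1 a1
  have a4 := abs_le.1 a2
  have a5 := abs_le.1 h2'
  rw [abs_le]
  constructor <;> nlinarith

end Step

/-! ### One step of the iteration. -/

/-- A maximizer `b` of a linear functional over the feasible set compares with the feasible
points on the normalized segment from `b` to `x`. -/
lemma interpolation_bound {p : ℕ} {b x θ : Vec p} {ℓ : ℝ} (hb : b ∈ feasible p ℓ)
    (hx : ‖x‖ = 1) (hℓ : 0 < ℓ) (hslack : ‖b - x‖ ^ 2 * ℓ ≤ ℓ - l1 x)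
    (hmax : ∀ v ∈ feasible p ℓ, inner ℝ v θ ≤ inner ℝ b θ) (h0 : 0 ≤ inner ℝ b θ) :
    ‖b - x‖ ^ 2 / 2 * inner ℝ b θ ≤ inner ℝ (b - x) θ := by
  obtain ⟨hb1, hbl⟩ := hb
  set G := ‖b - x‖ ^ 2 with hG
  have hG0 : 0 ≤ G := sq_nonneg _
  have hG1 : G ≤ 1 := by
    have := l1_nonneg x
    by_contra hc
    nlinarith
  -- The chord point z = (1 − a) b + a x has ‖z‖² = 1 − a(1 − a)G. Normalizing it inflates the ℓ₁
  -- norm, but moving towards `x` lowers the ℓ₁ bound by a(ℓ − ‖x‖₁) ≥ aGℓ, which suffices for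
  -- feasibility. The claim is the limit a → 0.
  have key : ∀ a : ℝ, 0 < a → a < 1 → (1 - a) * (G / 2 * inner ℝ b θ) ≤ inner ℝ (b - x) θ := by
    intro a ha ha1
    set z := (1 - a) • b + a • x with hz
    have hn : ‖z‖ ^ 2 = 1 - a * (1 - a) * G := by
      have e1 : inner ℝ b x = 1 - G / 2 := by
        have := norm_sub_sq_real b x
        rw [hb1, hx] at this
        rw [hG]
        linarith
      rw [hz, norm_add_sq_real, norm_smul, norm_smul, inner_smul_left, inner_smul_right, e1, hb1,
        hx, Real.norm_eq_abs, Real.norm_eq_abs, mul_one, mul_one, sq_abs, sq_abs]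
      simp only [conj_trivial]
      ring
    have hc : 0 ≤ a * (1 - a) := mul_nonneg ha.le (by linarith)
    have hc1 : a * (1 - a) ≤ 1 / 4 := by nlinarith [sq_nonneg (a - 1 / 2)]
    have hcG : a * (1 - a) * G ≤ 1 / 4 := by nlinarith
    have hcG0 : 0 ≤ a * (1 - a) * G := mul_nonneg hc hG0
    have hup : ‖z‖ ≤ 1 - a * (1 - a) * G / 2 := by
      apply le_of_sq_le_sq _ (by linarith)
      rw [hn]
      nlinarith [sq_nonneg (a * (1 - a) * G)]
    have hlo : 1 - a * (1 - a) * G ≤ ‖z‖ := by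
      apply le_of_sq_le_sq _ (norm_nonneg _)
      rw [hn]
      nlinarith
    have hzp : 0 < ‖z‖ := by linarith
    have hfeas : ‖z‖⁻¹ • z ∈ feasible p ℓ := by
      refine ⟨by rw [norm_smul, norm_inv, norm_norm, inv_mul_cancel₀ hzp.ne'], ?_⟩
      rw [l1_smul, abs_of_pos (inv_pos.2 hzp), inv_mul_le_iff₀ hzp]
      have h1 : l1 z ≤ (1 - a) * ℓ + a * l1 x := by
        refine (l1_add_le _ _).trans ?_
        rw [l1_smul, l1_smul, abs_of_pos ha, abs_of_pos (by linarith : 0 < 1 - a)]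
        have : (1 - a) * l1 b ≤ (1 - a) * ℓ := mul_le_mul_of_nonneg_left hbl (by linarith)
        linarith
      have h2 : a * (1 - a) * (G * ℓ) ≤ a * (1 - a) * (ℓ - l1 x) :=
        mul_le_mul_of_nonneg_left hslack hc
      have h3 : 0 ≤ ℓ - l1 x := (mul_nonneg hG0 hℓ.le).trans hslack
      have h4 : a * (1 - a) * (ℓ - l1 x) ≤ a * (ℓ - l1 x) :=
        mul_le_mul_of_nonneg_right (by nlinarith) h3
      have h5 : (1 - a * (1 - a) * G) * ℓ ≤ ‖z‖ * ℓ := by gcongr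
      nlinarith
    have h1 := hmax _ hfeas
    rw [inner_smul_left, conj_trivial, inv_mul_le_iff₀ hzp, hz, inner_add_left, inner_smul_left,
      inner_smul_left, conj_trivial, conj_trivial, ← hz] at h1
    have h2 : ‖z‖ * inner ℝ b θ ≤ (1 - a * (1 - a) * G / 2) * inner ℝ b θ := by gcongr
    rw [inner_sub_left]
    have h3 : a * ((1 - a) * (G / 2 * inner ℝ b θ)) ≤ a * (inner ℝ b θ - inner ℝ x θ) := by
      nlinarith
    exact le_of_mul_le_mul_left h3 ha
  have hc0 : 0 ≤ G / 2 * inner ℝ b θ := by positivity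
  -- The limit made explicit: if d < c, then a = (c − d)/(2c) gives (c + d)/2 ≤ d. The case a = 1/2
  -- yields d ≥ c/2, so that this `a` is below 1.
  have hh := key (1 / 2) (by norm_num) (by norm_num)
  by_contra hcon
  push Not at hcon
  set c := G / 2 * inner ℝ b θ
  set d := inner ℝ (b - x) θ
  have hcp : 0 < c := by linarith
  have hdiv : (c - d) / (2 * c) * c = (c - d) / 2 := by field_simp
  have := key ((c - d) / (2 * c)) (div_pos (by linarith) (by linarith))
    ((div_lt_one (by linarith)).2 (by linarith))
  nlinarith

/-- What comparison with `x` alone yields. It loses a constant factor, but it suffices to verify the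
slack condition of `interpolation_bound`. -/
lemma sq_le_of_rough_bound {G H e y q Kq Kr : ℝ} (hH : 0 ≤ H) (hH1 : H ≤ 1)
    (hKq : 0 ≤ Kq) (hq0 : 0 ≤ q) (hq : q ≤ Kq * (H ^ 2 + e))
    (hG2 : G ^ 2 / 2 ≤ G * H + q * G + Kr * (e * y)) :
    G ^ 2 ≤ (8 + 16 * Kq ^ 2) * H ^ 2 + 16 * Kq ^ 2 * e ^ 2 + 4 * (Kr * (e * y)) := by
  have h1 : q ≤ Kq * H + Kq * e := by nlinarith [mul_nonneg hKq hH]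
  have h2 : q ^ 2 ≤ (Kq * H + Kq * e) ^ 2 := by gcongr
  nlinarith [sq_nonneg (G - 2 * (H + q)), sq_nonneg (H - q), sq_nonneg (Kq * H - Kq * e)]

/-- Interpolation provides almost G² on the left instead of G²/2, so GH ≤ (G² + H²)/2 turns the
factor 1 − κ into a true contraction. Half of the margin κ absorbs the errors. -/
lemma sq_le_of_fine_bound {G H e y q Kq Kr κ σ : ℝ} (hG : 0 ≤ G) (hH : 0 ≤ H)
    (hκ : 0 < κ) (hκ1 : κ ≤ 1)
    (hq : q ≤ Kq * (H ^ 2 + e)) (hσ : σ ≤ κ / 8) (hKH : Kq * H ≤ κ / 8)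
    (hG2 : G ^ 2 * (1 - σ / 2) ≤ (1 - κ) * (G * H) + q * G + Kr * (e * y)) :
    G ^ 2 ≤ (1 - κ / 2) * H ^ 2 + 2 * (4 * Kq ^ 2 / κ * e ^ 2 + Kr * (e * y)) := by
  have h1 : q ≤ κ / 8 * H + Kq * e := by nlinarith
  have h2 : q * G ≤ κ / 8 * (G * H) + Kq * e * G := by nlinarith
  have h3 : Kq * e * G ≤ κ / 16 * G ^ 2 + 4 * Kq ^ 2 / κ * e ^ 2 := by
    have : κ / 16 * G ^ 2 + 4 * Kq ^ 2 / κ * e ^ 2 - Kq * e * G =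
        (κ * G - 8 * (Kq * e)) ^ 2 / (16 * κ) := by
      field_simp
      ring
    have h : 0 ≤ (κ * G - 8 * (Kq * e)) ^ 2 / (16 * κ) := by positivity
    linarith
  have h4 : G * H ≤ (G ^ 2 + H ^ 2) / 2 := by nlinarith [sq_nonneg (G - H)]
  have h5 : (1 - 7 * κ / 8) * (G * H) ≤ (1 - 7 * κ / 8) * ((G ^ 2 + H ^ 2) / 2) := by
    apply mul_le_mul_of_nonneg_left h4
    linarith
  have h6 : G ^ 2 * (σ / 2) ≤ G ^ 2 * (κ / 16) := 
    mul_le_mul_of_nonneg_left (by linarith) (sq_nonneg _)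
  have h7 : 0 ≤ κ * G ^ 2 := by positivity
  have h8 : 0 ≤ κ * H ^ 2 := by positivity
  nlinarith

section

variable {p : ℕ} {S L Sh Lh : Matrix (Fin p) (Fin p) ℝ} {x b β : Vec p} {r M γ e η : ℝ}

/-- The population version of the gradient step contracts off the leading direction. -/
lemma IsLeading.form_mul_le (h : IsLeading S L x r M γ) (hη : 0 < η)
    (hηM : η * M ≤ 1) {g u : Vec p} {a : ℝ} (ha : 0 ≤ a)
    (hg : (1 - a) * ‖g‖ ^ 2 ≤ η * (bil L g g - bil S g g / r))
    (hu : (1 - a) * ‖u‖ ^ 2 ≤ η * (bil L u u - bil S u u / r)) :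
    inner ℝ g u + η * (bil S g u / r - bil L g u) ≤ a * (‖g‖ * ‖u‖) := by
  -- Because ηM ≤ 1 this form is positive semidefinite, and Cauchy–Schwarz reduces the bilinear
  -- bound to the two quadratic ones.
  set B : Matrix (Fin p) (Fin p) ℝ := 1 + (η / r) • S - η • L with hB
  have hBe : ∀ v w : Vec p, bil B v w = inner ℝ v w + η * (bil S v w / r - bil L v w) := by
    intro v w
    rw [hB, bil_matrix_sub, bil_matrix_add, bil_one, bil_matrix_smul, bil_matrix_smul]
    ring
  have hsym : B.IsSymm := by
    have h1 := h.symm_left.eq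
    have h2 := h.symm_right.eq
    simp [Matrix.IsSymm, hB, Matrix.transpose_sub, Matrix.transpose_add, h1, h2]
  have hpos : ∀ v : Vec p, 0 ≤ bil B v v := by
    intro v
    rw [hBe, real_inner_self_eq_norm_sq]
    have h1 : 0 ≤ bil S v v / r := div_nonneg (h.nonneg v) h.pos.le
    have h2 := mul_le_mul_of_nonneg_left (h.upper v) hη.le
    have h3 : η * M * ‖v‖ ^ 2 ≤ 1 * ‖v‖ ^ 2 := by gcongr
    have h4 := mul_nonneg hη.le h1
    nlinarith
  rw [← hBe]
  refine (le_abs_self _).trans (abs_bil_le_of_quad_le hsym hpos ha (norm_nonneg _)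
    (norm_nonneg _) ?_ ?_)
  · rw [hBe, real_inner_self_eq_norm_sq]
    linarith
  · rw [hBe, real_inner_self_eq_norm_sq]
    linarith

set_option maxHeartbeats 1000000 in
/-- One step of the projected gradient iteration contracts the distance to the leading direction
up to the statistical error. -/
lemma IsLeading.step (h : IsLeading S L x r M γ) {s : ℕ} (hs : s = l0 x)
    (hc : IsClose S L Sh Lh s r e) (hM : 0 < M) (hγ : 0 < γ) (he : 0 ≤ e) (hη : 0 < η)
    (hηM : η * M ≤ 1) {A ℓ κ Kq c y : ℝ} (hA : 1 ≤ A) (hκ : κ = η * γ / (2 * M)) (hκ1 : κ ≤ 1)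
    (hKq : Kq = η * ((2 * M ^ 2 + 4 * M * (1 + A) ^ 2) * M + 9 * (1 + A)))
    (hβ : ‖β‖ = 1) (hβ1 : l1 β ≤ A * √(s : ℝ)) (hb : b ∈ feasible p ℓ)
    (hmax : ∀ v ∈ feasible p ℓ, inner ℝ v (gradStep Sh Lh η β) ≤ inner ℝ b (gradStep Sh Lh η β))
    (hℓ0 : 0 < ℓ) (hℓ : l1 x ≤ ℓ) (hℓA : ℓ ≤ A * √(s : ℝ)) (hy : y = (ℓ - l1 x) / √(s : ℝ))
    (hHc : ‖β - x‖ ^ 2 ≤ c) (hec : e ≤ c) (hc1 : c ≤ 1)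
    (hcM : (M + 2 * (1 + A) ^ 2) * c ≤ 1 / (2 * M)) (hcσ : (1 / 2 + Kq) * (2 * c) ≤ κ / 8)
    (hcq : Kq ^ 2 * c ≤ (κ / 8) ^ 2)
    (hslack : A * ((8 + 16 * Kq ^ 2) * ‖β - x‖ ^ 2 + 16 * Kq ^ 2 * e ^ 2 +
      4 * (3 * η * (1 + A) * (e * y))) ≤ y) :
    ‖b - x‖ ^ 2 ≤ (1 - κ / 2) * ‖β - x‖ ^ 2 +
      2 * (4 * Kq ^ 2 / κ * e ^ 2 + 3 * η * (1 + A) * (e * y)) := by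
  have hκ0 : 0 < κ := by rw [hκ]; positivity
  have hs0 : 0 < s := hs ▸ l0_pos h.norm_eq
  have hsq : 0 < √(s : ℝ) := Real.sqrt_pos.2 (by exact_mod_cast hs0)
  have hc0 : 0 ≤ c := he.trans hec
  have hy0 : 0 ≤ y := by rw [hy]; exact div_nonneg (by linarith) hsq.le
  have hr := h.pos
  obtain ⟨hb1, hbl⟩ := hb
  set G := ‖b - x‖ with hG
  set H := ‖β - x‖ with hH
  have hG0 : 0 ≤ G := norm_nonneg _
  have hH0 : 0 ≤ H := norm_nonneg _
  have hH1 : H ≤ 1 := (pow_le_one_iff_of_nonneg hH0 two_ne_zero).1 (hHc.trans hc1)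
  have hN : mixedNorm s β ≤ 1 + A := mixedNorm_le hs0 hβ hβ1
  have hsmall : M * H ^ 2 + 2 * (1 + A) ^ 2 * e ≤ 1 / (2 * M) := by
    refine le_trans ?_ hcM
    rw [add_mul]
    gcongr
  set θ := gradStep Sh Lh η β with hθ
  have herr := h.abs_inner_gradStep_sub_le hc hM hγ.le he hη hβ hN hsmall
  rw [← hH, ← hθ] at herr
  set φ := 2 * M * (M * H ^ 2 + 2 * (1 + A) ^ 2 * e) with hφ
  have hφ0 : 0 ≤ φ := by positivity
  have hφ1 : φ ≤ (2 * M ^ 2 + 4 * M * (1 + A) ^ 2) * (H ^ 2 + e) := by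
    have h1 : 0 ≤ M ^ 2 * e := by positivity
    have h2 : 0 ≤ M * (1 + A) ^ 2 * H ^ 2 := by positivity
    rw [hφ]
    linarith
  -- the error along `b - x`
  have hNg : mixedNorm s (b - x) ≤ 3 * G + y := by
    have h1 := mixedNorm_sub_le (b := b) h.norm_eq
    rw [← hs] at h1
    have h2 := div_le_div_of_nonneg_right (sub_le_sub_right hbl (l1 x)) hsq.le
    rw [hy]
    linarith
  set q := η * (φ * M + 9 * (1 + A) * e) with hq
  have hq0 : 0 ≤ q := by positivity
  have hqK : q ≤ Kq * (H ^ 2 + e) := by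
    have h1 : 0 ≤ (1 + A) * H ^ 2 := by positivity
    rw [hq, hKq, mul_assoc η]
    refine mul_le_mul_of_nonneg_left ?_ hη.le
    linarith [mul_le_mul_of_nonneg_right hφ1 hM.le]
  have hgerr : inner ℝ (b - x) θ ≤ inner ℝ (b - x) β +
      η * (bil S (b - x) β / r - bil L (b - x) β) + q * G + 3 * η * (1 + A) * (e * y) := by
    have h1 := (abs_le.1 (herr (b - x))).2
    rw [← hG] at h1
    have h2 : 3 * e * (1 + A) * mixedNorm s (b - x) ≤ 3 * e * (1 + A) * (3 * G + y) := by gcongr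
    have h3 := mul_le_mul_of_nonneg_left h2 hη.le
    rw [hq]
    linarith
  have hgx : inner ℝ (b - x) x = -G ^ 2 / 2 := IsLeading.inner_sub_self hb1 h.norm_eq
  -- The linear map fixes `x`, so β may be recentered at `x`; the remaining ⟨b − x, x⟩ supplies the
  -- term −G²/2.
  have hmain : inner ℝ (b - x) β + η * (bil S (b - x) β / r - bil L (b - x) β) =
      -G ^ 2 / 2 + (inner ℝ (b - x) (β - x) +
        η * (bil S (b - x) (β - x) / r - bil L (b - x) (β - x))) := by
    rw [inner_sub_right, hgx, bil_sub_right, bil_sub_right, h.eigen]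
    field_simp
    ring
  set Bgh := inner ℝ (b - x) (β - x) +
        η * (bil S (b - x) (β - x) / r - bil L (b - x) (β - x)) with hBgh
  -- comparison with `x`
  have hxmem : x ∈ feasible p ℓ := ⟨h.norm_eq, hℓ⟩
  have hxb := hmax x hxmem
  have hg0 : 0 ≤ inner ℝ (b - x) θ := by rw [inner_sub_left]; linarith
  have htop : ∀ u : Vec p, (1 - 1) * ‖u‖ ^ 2 ≤ η * (bil L u u - bil S u u / r) := by
    intro u
    rw [sub_self, zero_mul]
    refine mul_nonneg hη.le ?_
    rw [sub_nonneg, div_le_iff₀ hr]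
    linarith [h.le_top hM hγ.le u]
  -- Factor 1 needs no curvature: the condition ‖b − x‖² ≤ 2 is not available yet, and is derived
  -- from this bound.
  have hrough : Bgh ≤ 1 * (G * H) := h.form_mul_le hη hηM zero_le_one (htop _) (htop _)
  have hGr : G ^ 2 ≤ (8 + 16 * Kq ^ 2) * H ^ 2 + 16 * Kq ^ 2 * e ^ 2 +
      4 * (3 * η * (1 + A) * (e * y)) := by
    refine sq_le_of_rough_bound hH0 hH1 (by rw [hKq]; positivity) hq0 hqK ?_
    linarith
  have hGy : A * G ^ 2 ≤ y := le_trans (by gcongr) hslack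
  have hGℓ : G ^ 2 * ℓ ≤ ℓ - l1 x := by
    calc G ^ 2 * ℓ ≤ G ^ 2 * (A * √(s : ℝ)) := by gcongr
      _ = A * G ^ 2 * √(s : ℝ) := by ring
      _ ≤ y * √(s : ℝ) := by gcongr
      _ = ℓ - l1 x := by rw [hy]; field_simp
  have hG2 : G ^ 2 ≤ 2 := by
    have := l1_nonneg x
    have h1 : G ^ 2 ≤ 1 := le_of_mul_le_mul_right (by linarith) hℓ0
    linarith
  -- lower bound for the maximum
  have hxθ : 1 - κ / 8 ≤ inner ℝ x θ := by
    have h1 := (abs_le.1 (herr x)).1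
    have h2 : mixedNorm s x ≤ 2 := by
      have := mixedNorm_le (A := 1) hs0 h.norm_eq
        (by rw [one_mul, hs]; simpa [h.norm_eq] using l1_le_sqrt_l0 x)
      linarith
    have h3 : 3 * e * (1 + A) * mixedNorm s x ≤ 3 * e * (1 + A) * 2 := by gcongr
    have h4 : inner ℝ x β = 1 - H ^ 2 / 2 := by
      have := norm_sub_sq_real β x
      rw [hβ, h.norm_eq, real_inner_comm] at this
      rw [hH]
      linarith
    have h5 : bil S x β / r - bil L x β = 0 := by
      rw [bil_comm h.symm_left, h.eigen, bil_comm h.symm_right (u := x)]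
      field_simp
      ring
    rw [h.norm_eq, h5, h4] at h1
    have h6 : η * (φ * M * 1 + 3 * e * (1 + A) * mixedNorm s x) ≤ q := by
      rw [hq]
      have : 0 ≤ (1 + A) * e := by positivity
      refine mul_le_mul_of_nonneg_left ?_ hη.le
      linarith
    have h7 : (1 / 2 + Kq) * (H ^ 2 + e) ≤ (1 / 2 + Kq) * (2 * c) := by
      have : 0 ≤ Kq := by rw [hKq]; positivity
      gcongr
      linarith
    linarith
  have hbθ : 1 - κ / 8 ≤ inner ℝ b θ := hxθ.trans hxb
  have hbd := interpolation_bound ⟨hb1, hbl⟩ h.norm_eq hℓ0 hGℓ hmax (by linarith)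
  rw [← hG] at hbd
  have hH2 : H ^ 2 ≤ 2 := by linarith
  have hcurv : ∀ w : Vec p, ‖w‖ = 1 → ‖w - x‖ ^ 2 ≤ 2 →
      (1 - (1 - κ)) * ‖w - x‖ ^ 2 ≤
        η * (bil L (w - x) (w - x) - bil S (w - x) (w - x) / r) := by
    intro w hw hw2
    have h1 := h.curvature hM hγ.le hw hw2
    have h2 : γ / (2 * M) * ‖w - x‖ ^ 2 ≤
        bil L (w - x) (w - x) - bil S (w - x) (w - x) / r := by
      rw [le_sub_iff_add_le, ← le_sub_iff_add_le', div_le_iff₀ hr]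
      linarith
    calc (1 - (1 - κ)) * ‖w - x‖ ^ 2 = η * (γ / (2 * M) * ‖w - x‖ ^ 2) := by rw [hκ]; ring
      _ ≤ _ := by gcongr
  have hfine : Bgh ≤ (1 - κ) * (G * H) := h.form_mul_le hη hηM (by linarith)
    (hcurv b hb1 hG2) (hcurv β hβ hH2)
  refine sq_le_of_fine_bound (σ := κ / 8) hG0 hH0 hκ0 hκ1 hqK le_rfl ?_ ?_
  · apply le_of_sq_le_sq _ (by positivity)
    rw [mul_pow]
    exact le_trans (by gcongr) hcq
  · have : G ^ 2 / 2 * (1 - κ / 8) ≤ G ^ 2 / 2 * inner ℝ b θ := by gcongr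
    linarith

end

/-! ### Induction along the run. -/

lemma eventually_mul_le (a : ℝ) {b : ℝ} (hb : 0 < b) : ∀ᶠ c in 𝓝[>] (0 : ℝ), a * c ≤ b := by
  have h : Tendsto (fun c : ℝ => a * c) (𝓝[>] 0) (𝓝 (a * 0)) :=
    ((continuous_const_mul a).tendsto 0).mono_left nhdsWithin_le_nhds
  rw [mul_zero] at h
  exact h.eventually_le_const hb

lemma le_of_isNearest {p : ℕ} {b v θ : Vec p} (hb : ‖b‖ = 1) (hv : ‖v‖ = 1)
    (h : ‖b - θ‖ ^ 2 ≤ ‖v - θ‖ ^ 2) : inner ℝ v θ ≤ inner ℝ b θ := by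
  rw [norm_sub_sq_real, norm_sub_sq_real, hb, hv] at h
  linarith

set_option maxHeartbeats 1000000 in
/-- As long as the slack `y t = (ℓ t - ‖x‖₁) / √s` of the `ℓ₁` bounds dominates the statistical
error, the squared distance to the leading direction is controlled by the squared slack. -/
lemma exists_run_constants {M γ η A : ℝ} (hM : 0 < M) (hγ : 0 < γ) (hη : 0 < η)
    (hηM : η * M ≤ 1) (hκ1 : η * γ / (2 * M) ≤ 1) (hA : 1 ≤ A) :
    ∃ c : ℝ, 0 < c ∧ ∀ μ K₀ : ℝ, ∃ K₁ e₀ : ℝ, K₀ ≤ K₁ ∧ 0 < K₁ ∧ 0 < e₀ ∧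
      ∀ {p : ℕ} {S L Sh Lh : Matrix (Fin p) (Fin p) ℝ} {x : Vec p} {r e : ℝ} {s : ℕ},
      IsLeading S L x r M γ → s = l0 x → IsClose S L Sh Lh s r e → 0 < e → e ≤ e₀ →
      ∀ (b : ℕ → Vec p) (ℓ y : ℕ → ℝ), b 0 ∈ feasible p (ℓ 0) →
      (∀ t, b (t + 1) ∈ feasible p (ℓ (t + 1)) ∧ ∀ v ∈ feasible p (ℓ (t + 1)),
        inner ℝ v (gradStep Sh Lh η (b t)) ≤ inner ℝ (b (t + 1)) (gradStep Sh Lh η (b t))) →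
      (∀ t, ℓ t ≤ A * √(s : ℝ)) → (∀ t, y t = (ℓ t - l1 x) / √(s : ℝ)) →
      (∀ t, y t ≤ y (t + 1) + μ * e) → ‖b 0 - x‖ ^ 2 ≤ c * y 0 ^ 2 →
      ∀ t, (∀ i ≤ t, K₁ * e ≤ y i) → ‖b t - x‖ ^ 2 ≤ c * y t ^ 2 := by
  obtain ⟨κ, hκ⟩ : ∃ κ, κ = η * γ / (2 * M) := ⟨_, rfl⟩
  obtain ⟨Kq, hKq⟩ : ∃ Kq, Kq = η * ((2 * M ^ 2 + 4 * M * (1 + A) ^ 2) * M + 9 * (1 + A)) :=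
    ⟨_, rfl⟩
  obtain ⟨Kr, hKr⟩ : ∃ Kr, Kr = 3 * η * (1 + A) := ⟨_, rfl⟩
  rw [← hκ] at hκ1
  have hκ0 : 0 < κ := by rw [hκ]; positivity
  have hKq0 : 0 < Kq := by rw [hKq]; positivity
  have hKr0 : 0 < Kr := by rw [hKr]; positivity
  have hA0 : 0 < A := by linarith
  -- The squared radius, and the noise level, up to which `IsLeading.step` applies.
  obtain ⟨c₀, hc₀1, hc₀M, hc₀σ, hc₀q, hc₀⟩ : ∃ c₀ : ℝ, c₀ ≤ 1 ∧
      (M + 2 * (1 + A) ^ 2) * c₀ ≤ 1 / (2 * M) ∧ (1 / 2 + Kq) * (2 * c₀) ≤ κ / 8 ∧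
      Kq ^ 2 * c₀ ≤ (κ / 8) ^ 2 ∧ 0 < c₀ := by
    have h1 := eventually_mul_le 1 zero_lt_one
    have h2 := eventually_mul_le (M + 2 * (1 + A) ^ 2) (show 0 < 1 / (2 * M) by positivity)
    have h3 := eventually_mul_le ((1 / 2 + Kq) * 2) (show 0 < κ / 8 by positivity)
    have h4 := eventually_mul_le (Kq ^ 2) (show 0 < (κ / 8) ^ 2 by positivity)
    obtain ⟨c, ⟨⟨⟨⟨h1, h2⟩, h3⟩, h4⟩, h5⟩⟩ :=
      ((((h1.and h2).and h3).and h4).and self_mem_nhdsWithin).exists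
    exact ⟨c, by linarith, h2, by linarith, h4, h5⟩
  -- As y ≤ A, the first condition keeps c y² within the radius; by the second, the quadratic term
  -- of the rough bound uses at most half of the slack. The noise terms get the other half through
  -- `e₀`.
  obtain ⟨c, hcA, hcs, hc⟩ : ∃ c : ℝ, A ^ 2 * c ≤ c₀ ∧
      A * (8 + 16 * Kq ^ 2) * (2 * A) * c ≤ 1 / 2 ∧ 0 < c := by
    have h1 := eventually_mul_le (A ^ 2) hc₀
    have h2 := eventually_mul_le (A * (8 + 16 * Kq ^ 2) * (2 * A))
      (show (0 : ℝ) < 1 / 2 by norm_num)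
    obtain ⟨c, ⟨⟨h1, h2⟩, h5⟩⟩ := ((h1.and h2).and self_mem_nhdsWithin).exists
    exact ⟨c, h1, h2, h5⟩
  refine ⟨c, hc, fun μ K₀ => ?_⟩
  obtain ⟨e₀, he₀c, he₀s, he₀⟩ : ∃ e₀ : ℝ, e₀ ≤ c₀ ∧
      A * (16 * Kq ^ 2 + 4 * Kr) * e₀ ≤ 1 / 2 ∧ 0 < e₀ := by
    have h1 := eventually_mul_le 1 hc₀
    have h2 := eventually_mul_le (A * (16 * Kq ^ 2 + 4 * Kr)) (show (0 : ℝ) < 1 / 2 by norm_num)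
    obtain ⟨c, ⟨⟨h1, h2⟩, h5⟩⟩ := ((h1.and h2).and self_mem_nhdsWithin).exists
    exact ⟨c, by linarith, h2, h5⟩
  -- While y ≥ K₁ e, both the drop μ e of the slack and the noise of one step are small fractions of
  -- what the contraction gains.
  obtain ⟨K₁, hK₀, hK1, hKμ, hKc⟩ : ∃ K₁ : ℝ, K₀ ≤ K₁ ∧ 1 ≤ K₁ ∧ μ ≤ κ / 8 * K₁ ∧
      2 * (4 * Kq ^ 2 / κ + Kr) ≤ c * κ / 8 * K₁ := by
    have h1 := eventually_ge_atTop (α := ℝ) K₀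
    have h2 := eventually_ge_atTop (α := ℝ) 1
    have h3 := (tendsto_id.const_mul_atTop (show 0 < κ / 8 by positivity)).eventually_ge_atTop μ
    have h4 := (tendsto_id.const_mul_atTop (show 0 < c * κ / 8 by positivity)).eventually_ge_atTop
      (2 * (4 * Kq ^ 2 / κ + Kr))
    obtain ⟨K, ⟨⟨⟨h1, h2⟩, h3⟩, h4⟩⟩ := (((h1.and h2).and h3).and h4).exists
    exact ⟨K, h1, h2, h3, h4⟩
  refine ⟨K₁, e₀, hK₀, by linarith, he₀, ?_⟩
  intro p S L Sh Lh x r e s h hs hclose he hee b ℓ y hb0 hrun hℓA hy hdrop hstart t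
  have hs0 : 0 < s := hs ▸ l0_pos h.norm_eq
  have hsq : 0 < √(s : ℝ) := Real.sqrt_pos.2 (by exact_mod_cast hs0)
  have hfeas : ∀ t, b t ∈ feasible p (ℓ t) := by
    intro t
    cases t with
    | zero => exact hb0
    | succ t => exact (hrun t).1
  have hyA : ∀ t, y t ≤ A := by
    intro t
    rw [hy, div_le_iff₀ hsq]
    linarith [hℓA t, l1_nonneg x]
  induction t with
  | zero => exact fun _ => hstart
  | succ t ih =>
    intro hbig
    have hd := ih fun i hi => hbig i (by omega)
    have hyt : 0 ≤ y t := (mul_nonneg (by linarith) he.le).trans (hbig t (by omega))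
    have hy' := hbig (t + 1) le_rfl
    have hdr := hdrop t
    have hyA' := hyA t
    have hyt' := hy (t + 1)
    have hℓ' : l1 x < ℓ (t + 1) := by
      have h1 : 0 < y (t + 1) := lt_of_lt_of_le (by positivity) hy'
      rw [hyt'] at h1
      have := (div_pos_iff_of_pos_right hsq).1 h1
      linarith
    set z := y (t + 1) with hz
    have he1 : e ≤ z := by nlinarith
    have hz0 : 0 < z := lt_of_lt_of_le he he1
    have hμ : μ * e ≤ κ / 8 * z := by
      calc μ * e ≤ κ / 8 * K₁ * e := by gcongr
        _ = κ / 8 * (K₁ * e) := by ring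
        _ ≤ _ := by gcongr
    have hyz : y t ≤ (1 + κ / 8) * z := by linarith
    have hyz2 : y t ≤ 2 * z := hyz.trans (by gcongr; linarith)
    have hee' : e ^ 2 ≤ e * z := by rw [pow_two]; gcongr
    have hd2 : ‖b t - x‖ ^ 2 ≤ 2 * A * c * z := by
      calc ‖b t - x‖ ^ 2 ≤ c * y t ^ 2 := hd
        _ = c * (y t * y t) := by ring
        _ ≤ c * (A * (2 * z)) := by gcongr
        _ = _ := by ring
    have hstep := h.step hs hclose hM hγ he.le hη hηM (β := b t) (b := b (t + 1))
      (ℓ := ℓ (t + 1)) (c := c₀) (y := z) hA hκ hκ1 hKq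
      (hfeas t).1 ((hfeas t).2.trans (hℓA t)) (hfeas (t + 1)) (hrun t).2
      ((l1_nonneg x).trans_lt hℓ') hℓ'.le (hℓA (t + 1)) hyt' ?_ (hee.trans he₀c) hc₀1 hc₀M hc₀σ
      hc₀q ?_
    · rw [← hKr] at hstep
      refine hstep.trans ?_
      have h1 : y t ^ 2 ≤ ((1 + κ / 8) * z) ^ 2 := by gcongr
      have h2 : (1 - κ / 2) * ‖b t - x‖ ^ 2 ≤ (1 - κ / 2) * (c * ((1 + κ / 8) * z) ^ 2) := by
        have : 0 ≤ 1 - κ / 2 := by linarith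
        gcongr
        exact hd.trans (by gcongr)
      have h3 : 2 * (4 * Kq ^ 2 / κ * e ^ 2 + Kr * (e * z)) ≤ c * κ / 8 * z ^ 2 := by
        calc 2 * (4 * Kq ^ 2 / κ * e ^ 2 + Kr * (e * z))
            ≤ 2 * (4 * Kq ^ 2 / κ * (e * z) + Kr * (e * z)) := by gcongr
          _ = 2 * (4 * Kq ^ 2 / κ + Kr) * (e * z) := by ring
          _ ≤ c * κ / 8 * K₁ * (e * z) := by gcongr
          _ = c * κ / 8 * (K₁ * e * z) := by ring
          _ ≤ c * κ / 8 * (z * z) := by gcongr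
          _ = _ := by ring
      -- The contraction pays for the ratio y t / z ≤ 1 + κ/8, squared, and leaves κ/8 for the
      -- noise.
      have h4 : (1 - κ / 2) * (1 + κ / 8) ^ 2 ≤ 1 - κ / 8 := by
        linarith [sq_nonneg κ, pow_pos hκ0 3]
      have h5 : (1 - κ / 2) * (1 + κ / 8) ^ 2 * (c * z ^ 2) ≤ (1 - κ / 8) * (c * z ^ 2) := by
        gcongr
      calc _ ≤ (1 - κ / 2) * (c * ((1 + κ / 8) * z) ^ 2) + c * κ / 8 * z ^ 2 :=
            add_le_add h2 h3
        _ ≤ _ := by linarith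
    · calc ‖b t - x‖ ^ 2 ≤ c * y t ^ 2 := hd
        _ ≤ c * A ^ 2 := by gcongr
        _ = A ^ 2 * c := mul_comm _ _
        _ ≤ c₀ := hcA
    · rw [← hKr]
      have h1 : A * (8 + 16 * Kq ^ 2) * ‖b t - x‖ ^ 2 ≤ 1 / 2 * z := by
        calc A * (8 + 16 * Kq ^ 2) * ‖b t - x‖ ^ 2
            ≤ A * (8 + 16 * Kq ^ 2) * (2 * A * c * z) := by gcongr
          _ = A * (8 + 16 * Kq ^ 2) * (2 * A) * c * z := by ring
          _ ≤ _ := by gcongr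
      have h2 : A * (16 * Kq ^ 2 * e ^ 2 + 4 * (Kr * (e * z))) ≤ 1 / 2 * z := by
        calc A * (16 * Kq ^ 2 * e ^ 2 + 4 * (Kr * (e * z)))
            ≤ A * (16 * Kq ^ 2 * (e * z) + 4 * (Kr * (e * z))) := by gcongr
          _ = A * (16 * Kq ^ 2 + 4 * Kr) * e * z := by ring
          _ ≤ A * (16 * Kq ^ 2 + 4 * Kr) * e₀ * z := by gcongr
          _ ≤ _ := by gcongr
      linarith

/-! ### Comparison of penalized Rayleigh quotients. -/

section Penalized

variable {p : ℕ} {S L Sh Lh : Matrix (Fin p) (Fin p) ℝ} {x b : Vec p} {r M γ e N₀ : ℝ} {s : ℕ}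

lemma mixedNorm_add_le (s : ℕ) (u v : Vec p) :
    mixedNorm s (u + v) ≤ mixedNorm s u + mixedNorm s v := by
  have h1 := norm_add_le u v
  have h2 := div_le_div_of_nonneg_right (l1_add_le u v) (Real.sqrt_nonneg (s : ℝ))
  rw [add_div] at h2
  simp only [mixedNorm]
  linarith

@[simp] lemma mixedNorm_neg (s : ℕ) (u : Vec p) : mixedNorm s (-u) = mixedNorm s u := by
  simp [mixedNorm]

lemma norm_le_mixedNorm (s : ℕ) (u : Vec p) : ‖u‖ ≤ mixedNorm s u :=
  le_add_of_nonneg_right (div_nonneg (l1_nonneg _) (Real.sqrt_nonneg _))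

/-- The empirical Rayleigh quotient, recentered at the leading direction, is up to the statistical
error the quotient of the population form of the displacement. -/
lemma IsLeading.rayleigh_expansion (h : IsLeading S L x r M γ) (hc : IsClose S L Sh Lh s r e)
    (hM : 0 < M) (hγ : 0 ≤ γ) (he : 0 ≤ e) (hN2 : 2 ≤ N₀) (hx : mixedNorm s x ≤ 2)
    (hsmall : 4 * N₀ ^ 2 * e ≤ 1 / (2 * M)) (hb : ‖b‖ = 1)
    (hb' : mixedNorm s b ≤ N₀) :
    ∃ Q D : ℝ, rayleigh Sh Lh b - rayleigh Sh Lh x = Q / D ∧ 1 / (2 * M) ≤ D ∧ D ≤ 2 * M ∧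
      |Q - (bil S (b - x) (b - x) - r * bil L (b - x) (b - x))| ≤
        r * ((3 + 8 * M ^ 2 * N₀ ^ 2) * (4 * N₀) * (e * mixedNorm s (b - x))) := by
  have hr := h.pos
  have hx' : mixedNorm s x ≤ N₀ := hx.trans hN2
  have hNe : 0 ≤ N₀ ^ 2 * e := by positivity
  obtain ⟨hf, hφ⟩ := h.rayleigh_close hc hM hγ he h.norm_eq hx'
    (by rw [sub_self, norm_zero]; linarith)
  rw [sub_self, norm_zero] at hφ
  set f := rayleigh Sh Lh x with hfdef
  have hφ' : |r / f - 1| ≤ 4 * M * N₀ ^ 2 * e := hφ.trans (le_of_eq (by ring))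
  have hφ1 : 4 * M * N₀ ^ 2 * e ≤ 1 / 2 := by
    calc 4 * M * N₀ ^ 2 * e = M * (4 * N₀ ^ 2 * e) := by ring
      _ ≤ M * (1 / (2 * M)) := by gcongr
      _ = 1 / 2 := by field_simp
  have hf2 : f ≤ 2 * r := by
    have h1 := (abs_le.1 hφ').1
    have h2 : 1 / 2 ≤ r / f := by linarith
    rw [le_div_iff₀ hf] at h2
    linarith
  have hfr : |r - f| ≤ r * (8 * M * N₀ ^ 2 * e) := by
    have h1 : r - f = f * (r / f - 1) := by field_simp
    rw [h1, abs_mul, abs_of_pos hf]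
    calc f * |r / f - 1| ≤ 2 * r * (4 * M * N₀ ^ 2 * e) := by gcongr
      _ = _ := by ring
  have hLpos : ∀ u : Vec p, ‖u‖ = 1 → mixedNorm s u ≤ N₀ →
      1 / (2 * M) ≤ bil Lh u u ∧ bil Lh u u ≤ 2 * M := by
    intro u hu hu'
    have h1 := abs_le.1 (hc.quad_right he hu')
    have h2 := h.upper u
    have h3 := h.lower u
    rw [hu] at h2 h3
    have h4 : 2 * (1 / (2 * M)) ≤ bil L u u := by
      rw [← mul_div_assoc, div_le_iff₀ (by positivity)]
      linarith
    constructor <;> linarith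
  have hQx : bil Sh x x - f * bil Lh x x = 0 := by
    have h1 : 0 < bil Lh x x := lt_of_lt_of_le (by positivity) (hLpos x h.norm_eq hx').1
    rw [hfdef, rayleigh, quad_eq_bil, quad_eq_bil, div_mul_cancel₀ _ h1.ne', sub_self]
  have hdev : ∀ u v : Vec p, |(bil Sh u v - f * bil Lh u v) - (bil S u v - r * bil L u v)| ≤
      r * ((3 + 8 * M ^ 2 * N₀ ^ 2) * e * (mixedNorm s u * mixedNorm s v)) := by
    intro u v
    have h1 := hc.left u v
    have h2 := hc.right u v
    have hNN : 0 ≤ mixedNorm s u * mixedNorm s v :=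
      mul_nonneg (mixedNorm_nonneg _ _) (mixedNorm_nonneg _ _)
    have h3 : |bil L u v| ≤ M * (mixedNorm s u * mixedNorm s v) := by
      refine (h.abs_right_le hM u v).trans ?_
      have := mixedNorm_nonneg s u
      gcongr <;> exact norm_le_mixedNorm _ _
    have h4 : |f * (bil Lh u v - bil L u v)| ≤
        2 * r * (e * (mixedNorm s u * mixedNorm s v)) := by
      rw [abs_mul, abs_of_pos hf]
      gcongr
    have h5 : |(r - f) * bil L u v| ≤
        r * (8 * M * N₀ ^ 2 * e) * (M * (mixedNorm s u * mixedNorm s v)) := by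
      rw [abs_mul]
      gcongr
    have e1 : (bil Sh u v - f * bil Lh u v) - (bil S u v - r * bil L u v) =
        (bil Sh u v - bil S u v) - f * (bil Lh u v - bil L u v) + (r - f) * bil L u v := by
      ring
    rw [e1]
    refine (abs_add_le _ _).trans ((add_le_add_left (abs_sub _ _) _).trans ?_)
    linarith
  refine ⟨bil Sh b b - f * bil Lh b b, bil Lh b b, ?_, (hLpos b hb hb').1, (hLpos b hb hb').2, ?_⟩
  · have h1 : 0 < bil Lh b b := lt_of_lt_of_le (by positivity) (hLpos b hb hb').1
    rw [rayleigh, quad_eq_bil, quad_eq_bil]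
    field_simp
  have hbe : b = (b - x) + x := by simp
  have hg : mixedNorm s (b - x) ≤ N₀ + 2 := by
    rw [sub_eq_add_neg]
    refine (mixedNorm_add_le _ _ _).trans ?_
    rw [mixedNorm_neg]
    linarith
  have hg0 := mixedNorm_nonneg s (b - x)
  have hx0 := mixedNorm_nonneg s x
  have h1 := hdev (b - x) (b - x)
  have h2 := hdev (b - x) x
  have h3 := hdev x (b - x)
  -- The population cross terms with `x` vanish by the eigenvector equation, so the empirical ones
  -- are pure noise, linear in b − x.
  rw [h.eigen, sub_self, sub_zero] at h2
  rw [bil_comm h.symm_left (u := x), bil_comm h.symm_right (u := x), h.eigen, sub_self,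
    sub_zero] at h3
  have e2 : bil Sh b b - f * bil Lh b b = (bil Sh (b - x) (b - x) - f * bil Lh (b - x) (b - x)) +
      (bil Sh (b - x) x - f * bil Lh (b - x) x) + (bil Sh x (b - x) - f * bil Lh x (b - x)) := by
    have e3 : ∀ T : Matrix (Fin p) (Fin p) ℝ, bil T b b = bil T (b - x) (b - x) +
        bil T (b - x) x + bil T x (b - x) + bil T x x := by
      intro T
      simp only [bil_sub_left, bil_sub_right]
      ring
    rw [e3 Sh, e3 Lh]
    linarith
  rw [e2]
  set K := 3 + 8 * M ^ 2 * N₀ ^ 2 with hK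
  have hK0 : 0 ≤ K := by positivity
  set n := mixedNorm s (b - x) with hn
  -- Here n ≤ N₀ + 2 and the mixed norm of `x` is at most 2; N₀ + 6 ≤ 4 N₀ since N₀ ≥ 2.
  have e4 : n * n + n * mixedNorm s x + mixedNorm s x * n ≤ 4 * N₀ * n := by
    have : n * (n + mixedNorm s x + mixedNorm s x) ≤ n * (4 * N₀) := by
      gcongr
      linarith
    linarith
  have e5 : r * (K * e * (n * n + n * mixedNorm s x + mixedNorm s x * n)) ≤
      r * (K * e * (4 * N₀ * n)) := by gcongr
  have a1 := abs_le.1 h1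
  have a2 := abs_le.1 h2
  have a3 := abs_le.1 h3
  rw [abs_le]
  constructor <;> linarith

lemma div_le_of_le_sub {Q D P R M : ℝ} (hM : 0 < M) (hD : 1 / (2 * M) ≤ D) (hD' : D ≤ 2 * M)
    (hP : 0 ≤ P) (hR : 0 ≤ R) (h : Q ≤ R - P) : Q / D ≤ 2 * M * R - P / (2 * M) := by
  have hD0 : 0 < D := lt_of_lt_of_le (by positivity) hD
  rw [div_le_iff₀ hD0]
  have h1 : 1 * R ≤ 2 * M * D * R := by
    gcongr
    rw [div_le_iff₀ (by positivity)] at hD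
    linarith
  have h2 : P / (2 * M) * D ≤ P := by
    calc P / (2 * M) * D ≤ P / (2 * M) * (2 * M) := by gcongr
      _ = P := by field_simp
  linarith

/-- The lasso-type argument: a vector whose penalized Rayleigh quotient is at least that of a
vector within the statistical error of the leading direction is itself within that error. -/
lemma sq_le_of_penalized {G e τ c₂ A K₈ K₅ c₁ n m l ν a : ℝ} (hG : 0 ≤ G) (he : 0 ≤ e)
    (hc₂ : 0 < c₂) (hA : 0 < A) (hc₁ : 0 < c₁) (hK₈ : 0 ≤ K₈) (hτ : K₈ ≤ τ) (ha : 0 ≤ a)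
    (hn0 : 0 ≤ n) (hnA : n ≤ A) (hm0 : 0 ≤ m) (hmA : m ≤ A) (hl0 : 0 ≤ l) (hlA : l ≤ A)
    (hml : m - l ≤ a * e) (hnl : l - n ≤ G) (hν : ν ≤ 3 * G + (n - l))
    (h : c₁ * G ^ 2 + τ * e * ((n + c₂ * n ^ 2 / A) - (m + c₂ * m ^ 2 / A)) ≤
      K₈ * (e * ν) + K₅ * e ^ 2) :
    G ^ 2 ≤ ((3 * K₈ + τ * (1 + 2 * c₂)) ^ 2 / c₁ ^ 2 +
      2 * (K₅ + τ * a * (1 + 2 * c₂)) / c₁) * e ^ 2 := by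
  have hτ0 : 0 ≤ τ := hK₈.trans hτ
  have fac : ∀ u v : ℝ, (u + c₂ * u ^ 2 / A) - (v + c₂ * v ^ 2 / A) =
      (u - v) * (1 + c₂ * ((u + v) / A)) := by
    intro u v
    field_simp
    ring
  have rng : ∀ u v : ℝ, 0 ≤ u → u ≤ A → 0 ≤ v → v ≤ A →
      1 ≤ 1 + c₂ * ((u + v) / A) ∧ 1 + c₂ * ((u + v) / A) ≤ 1 + 2 * c₂ := by
    intro u v hu hu' hv hv'
    have h1 : 0 ≤ (u + v) / A := by positivity
    have h2 : (u + v) / A ≤ 2 := by rw [div_le_iff₀ hA]; linarith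
    constructor <;> nlinarith
  have hPm : (m + c₂ * m ^ 2 / A) - (l + c₂ * l ^ 2 / A) ≤ a * e * (1 + 2 * c₂) := by
    rw [fac]
    obtain ⟨h1, h2⟩ := rng m l hm0 hmA hl0 hlA
    rcases le_or_gt m l with hle | hlt
    · have : (m - l) * (1 + c₂ * ((m + l) / A)) ≤ 0 :=
        mul_nonpos_of_nonpos_of_nonneg (by linarith) (by linarith)
      have : 0 ≤ a * e * (1 + 2 * c₂) := by positivity
      linarith
    · exact mul_le_mul hml h2 (by linarith) (by positivity)
  have hPm' := mul_le_mul_of_nonneg_left hPm (mul_nonneg hτ0 he)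
  have hmain : c₁ * G ^ 2 ≤ (3 * K₈ + τ * (1 + 2 * c₂)) * (e * G) +
      (K₅ + τ * a * (1 + 2 * c₂)) * e ^ 2 := by
    have hPn := fac n l
    obtain ⟨h1, h2⟩ := rng n l hn0 hnA hl0 hlA
    have hν' := mul_le_mul_of_nonneg_left (mul_le_mul_of_nonneg_left hν he) hK₈
    have heG : 0 ≤ τ * (1 + 2 * c₂) * (e * G) := by positivity
    -- If the ℓ₁ norm exceeds that of `x`, the noise in the excess is paid for by the penalty, whose
    -- slope is at least 1 and whose level is τ ≥ K₈. Otherwise the deficit is at most G and costs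
    -- only O(e G).
    rcases le_or_gt l n with hle | hlt
    · have h3 : (n - l) * 1 ≤ (n - l) * (1 + c₂ * ((n + l) / A)) :=
        mul_le_mul_of_nonneg_left h1 (by linarith)
      rw [← hPn] at h3
      have h4 := mul_le_mul_of_nonneg_left h3 (mul_nonneg hτ0 he)
      have h5 : K₈ * (e * (n - l)) ≤ τ * (e * (n - l)) :=
        mul_le_mul_of_nonneg_right hτ (mul_nonneg he (by linarith))
      linarith
    · have h3 : (l - n) * (1 + c₂ * ((n + l) / A)) ≤ G * (1 + 2 * c₂) :=
        mul_le_mul hnl h2 (by linarith) hG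
      have h4 := mul_le_mul_of_nonneg_left h3 (mul_nonneg hτ0 he)
      have h5 : 0 ≤ K₈ * (e * (l - n)) := mul_nonneg hK₈ (mul_nonneg he (by linarith))
      have h6 : τ * e * ((n + c₂ * n ^ 2 / A) - (l + c₂ * l ^ 2 / A)) =
          -(τ * e * ((l - n) * (1 + c₂ * ((n + l) / A)))) := by rw [hPn]; ring
      linarith
  set K := 3 * K₈ + τ * (1 + 2 * c₂)
  set K' := K₅ + τ * a * (1 + 2 * c₂)
  -- Completing the square in c₁ G² ≤ K e G + K' e².
  have h1 : (K ^ 2 / c₁ ^ 2 + 2 * K' / c₁) * e ^ 2 =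
      (2 / c₁) * (K * (e * G) + K' * e ^ 2) - G ^ 2 + (G - K * e / c₁) ^ 2 := by
    field_simp
    ring
  have h2 : (2 / c₁) * (c₁ * G ^ 2) ≤ (2 / c₁) * (K * (e * G) + K' * e ^ 2) := by gcongr
  have h3 : (2 / c₁) * (c₁ * G ^ 2) = 2 * G ^ 2 := by field_simp
  have h4 := sq_nonneg (G - K * e / c₁)
  linarith

/-- Constants for the comparison of penalized Rayleigh quotients. -/
lemma exists_penalized_constants {M γ A : ℝ} (hM : 0 < M) (hγ : 0 < γ) (hA : 1 ≤ A) :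
    ∃ τ₀ e₀ : ℝ, 0 < τ₀ ∧ 0 < e₀ ∧ ∀ τ c₂ a : ℝ, τ₀ ≤ τ → 0 < c₂ → 0 < a → ∃ K : ℝ, 0 < K ∧
      ∀ {p : ℕ} {S L Sh Lh : Matrix (Fin p) (Fin p) ℝ} {x : Vec p} {r e : ℝ} {s : ℕ},
      IsLeading S L x r M γ → s = l0 x → IsClose S L Sh Lh s r e → 0 ≤ e → e ≤ e₀ →
      ∀ b w : Vec p, ‖b‖ = 1 → ‖w‖ = 1 → l1 b ≤ A * √(s : ℝ) → l1 w ≤ A * √(s : ℝ) →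
      ‖b - x‖ ^ 2 ≤ 2 → ‖w - x‖ ≤ a * e → (l1 w - l1 x) / √(s : ℝ) ≤ a * e →
      rayleigh Sh Lh w - r * (τ * e * (l1 w / √(s : ℝ) + c₂ * (l1 w / √(s : ℝ)) ^ 2 / A)) ≤
        rayleigh Sh Lh b - r * (τ * e * (l1 b / √(s : ℝ) + c₂ * (l1 b / √(s : ℝ)) ^ 2 / A)) →
      ‖b - x‖ ^ 2 ≤ K * e ^ 2 := by
  obtain ⟨N₀, hN₀⟩ : ∃ N₀, N₀ = 1 + A := ⟨_, rfl⟩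
  have hN2 : 2 ≤ N₀ := by linarith
  have hA0 : 0 < A := by linarith
  obtain ⟨e₀, he₀s, he₀⟩ : ∃ e₀ : ℝ, 4 * N₀ ^ 2 * e₀ ≤ 1 / (2 * M) ∧ 0 < e₀ :=
    ((eventually_mul_le (4 * N₀ ^ 2) (show 0 < 1 / (2 * M) by positivity)).and
      self_mem_nhdsWithin).exists
  obtain ⟨K₃, hK₃⟩ : ∃ K₃, K₃ = (3 + 8 * M ^ 2 * N₀ ^ 2) * (4 * N₀) := ⟨_, rfl⟩
  have hK₃0 : 0 < K₃ := by rw [hK₃]; positivity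
  refine ⟨2 * M * K₃, e₀, by positivity, he₀, fun τ c₂ a hτ hc₂ ha => ?_⟩
  have hτ0 : 0 < τ := lt_of_lt_of_le (by positivity) hτ
  -- The constant of `sq_le_of_penalized` with c₁ = γ/(4M²), the curvature γ/(2M) over the largest
  -- denominator 2M, and K₈ = 2 M K₃, the noise over the smallest denominator 1/(2M).
  refine ⟨(3 * (2 * M * K₃) + τ * (1 + 2 * c₂)) ^ 2 / (γ / (4 * M ^ 2)) ^ 2 +
    2 * (2 * M * (M * a ^ 2 + K₃ * (4 * a)) + τ * a * (1 + 2 * c₂)) / (γ / (4 * M ^ 2)),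
    by positivity, ?_⟩
  intro p S L Sh Lh x r e s h hs hc he hee b w hb hw hb1 hw1 hb2 hwx hwl hcmp
  have hr := h.pos
  have hs0 : 0 < s := hs ▸ l0_pos h.norm_eq
  have hsq : 0 < √(s : ℝ) := Real.sqrt_pos.2 (by exact_mod_cast hs0)
  have hxl : l1 x ≤ 1 * √(s : ℝ) := by
    rw [one_mul, hs]
    simpa [h.norm_eq] using l1_le_sqrt_l0 x
  have hxN : mixedNorm s x ≤ 2 := (mixedNorm_le hs0 h.norm_eq hxl).trans (by norm_num)
  have hsmall : 4 * N₀ ^ 2 * e ≤ 1 / (2 * M) := le_trans (by gcongr) he₀s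
  have hbN : mixedNorm s b ≤ N₀ := hN₀ ▸ mixedNorm_le hs0 hb hb1
  have hwN : mixedNorm s w ≤ N₀ := hN₀ ▸ mixedNorm_le hs0 hw hw1
  obtain ⟨Q, D, hQ, hD, hD', hQD⟩ := h.rayleigh_expansion hc hM hγ.le he hN2 hxN hsmall hb hbN
  obtain ⟨Q', E, hQ', hE, hE', hQE⟩ := h.rayleigh_expansion hc hM hγ.le he hN2 hxN hsmall hw hwN
  rw [← hK₃] at hQD hQE
  have hν : ∀ u : Vec p, mixedNorm s (u - x) ≤ 3 * ‖u - x‖ + (l1 u - l1 x) / √(s : ℝ) := by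
    intro u
    rw [hs]
    exact mixedNorm_sub_le h.norm_eq
  have hbg := mixedNorm_nonneg s (b - x)
  have hup : rayleigh Sh Lh b - rayleigh Sh Lh x ≤
      r * (2 * M * K₃ * (e * mixedNorm s (b - x)) - γ / (4 * M ^ 2) * ‖b - x‖ ^ 2) := by
    rw [hQ]
    refine (div_le_of_le_sub (P := γ / (2 * M) * r * ‖b - x‖ ^ 2)
      (R := r * (K₃ * (e * mixedNorm s (b - x)))) hM hD hD' (by positivity) (by positivity)
      ?_).trans (le_of_eq ?_)
    · have h1 := h.curvature hM hγ.le hb hb2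
      have h2 := (abs_le.1 hQD).2
      linarith
    · field_simp
      ring
  have hlow : rayleigh Sh Lh x - rayleigh Sh Lh w ≤
      r * (2 * M * (M * a ^ 2 + K₃ * (4 * a)) * e ^ 2) := by
    have h0 : rayleigh Sh Lh x - rayleigh Sh Lh w = (-Q') / E := by
      rw [neg_div, ← hQ']
      ring
    rw [h0]
    refine (div_le_of_le_sub (P := 0) (R := r * ((M * a ^ 2 + K₃ * (4 * a)) * e ^ 2)) hM hE hE'
      le_rfl (by positivity) ?_).trans (le_of_eq (by ring))
    have h1 := (abs_le.1 hQE).1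
    have h2 := h.nonneg (w - x)
    have h3 : bil L (w - x) (w - x) ≤ M * (a * e) ^ 2 := (h.upper _).trans (by gcongr)
    have h4 := mul_le_mul_of_nonneg_left h3 hr.le
    have h5 : mixedNorm s (w - x) ≤ 4 * (a * e) := by linarith [hν w]
    have h6 : r * (K₃ * (e * mixedNorm s (w - x))) ≤ r * (K₃ * (e * (4 * (a * e)))) := by gcongr
    linarith
  have hall : γ / (4 * M ^ 2) * ‖b - x‖ ^ 2 + τ * e *
      ((l1 b / √(s : ℝ) + c₂ * (l1 b / √(s : ℝ)) ^ 2 / A) -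
        (l1 w / √(s : ℝ) + c₂ * (l1 w / √(s : ℝ)) ^ 2 / A)) ≤
      2 * M * K₃ * (e * mixedNorm s (b - x)) +
        2 * M * (M * a ^ 2 + K₃ * (4 * a)) * e ^ 2 := by
    refine le_of_mul_le_mul_left ?_ hr
    linarith
  have hl1 : ∀ u : Vec p, 0 ≤ l1 u / √(s : ℝ) := fun u => div_nonneg (l1_nonneg u) hsq.le
  refine sq_le_of_penalized (m := l1 w / √(s : ℝ)) (n := l1 b / √(s : ℝ))
    (l := l1 x / √(s : ℝ)) (ν := mixedNorm s (b - x)) (norm_nonneg _) he hc₂ hA0 (by positivity)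
    (by positivity) hτ ha.le (hl1 b) ((div_le_iff₀ hsq).2 hb1) (hl1 w) ((div_le_iff₀ hsq).2 hw1)
    (hl1 x) ((div_le_iff₀ hsq).2 (hxl.trans (by gcongr))) ?_ ?_ ?_ hall
  · rwa [← sub_div]
  · rw [← sub_div, div_le_iff₀ hsq, mul_comm, hs]
    exact l1_sub_l1_le b x
  · rw [← sub_div]
    exact hν b

end Penalized

/-! ### From sparse vectors to all vectors. -/

section Sparse

variable {p : ℕ}

/-- The vectors supported on `T`. -/
def supportedOn (T : Finset (Fin p)) : Submodule ℝ (Vec p) where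
  carrier := {u | ∀ j ∉ T, u j = 0}
  add_mem' hu hv j hj := by simp [hu j hj, hv j hj]
  zero_mem' j _ := by simp
  smul_mem' c u hu j hj := by simp [hu j hj]

lemma supportedOn_mono {T U : Finset (Fin p)} (h : T ⊆ U) : supportedOn T ≤ supportedOn U :=
  fun _ hu j hj => hu j fun hT => hj (h hT)

/-- The restriction of `u` to the coordinates in `T`. -/
def restr (T : Finset (Fin p)) (u : Vec p) : Vec p :=
  WithLp.toLp 2 fun j => if j ∈ T then u j else 0

@[simp] lemma restr_apply (T : Finset (Fin p)) (u : Vec p) (j : Fin p) :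
    restr T u j = if j ∈ T then u j else 0 := rfl

lemma restr_mem (T : Finset (Fin p)) (u : Vec p) : restr T u ∈ supportedOn T :=
  fun j hj => by simp [hj]

lemma norm_sq_restr (T : Finset (Fin p)) (u : Vec p) : ‖restr T u‖ ^ 2 = ∑ j ∈ T, u j ^ 2 := by
  rw [EuclideanSpace.norm_sq_eq]
  simp [Finset.sum_ite_mem, apply_ite (fun a : ℝ => a ^ 2)]

lemma norm_restr_le (T : Finset (Fin p)) (u : Vec p) : ‖restr T u‖ ≤ ‖u‖ := by
  apply le_of_sq_le_sq _ (norm_nonneg _)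
  rw [norm_sq_restr, EuclideanSpace.norm_sq_eq]
  simp only [Real.norm_eq_abs, sq_abs]
  exact Finset.sum_le_univ_sum_of_nonneg fun _ => sq_nonneg _

lemma l1_restr (T : Finset (Fin p)) (u : Vec p) : l1 (restr T u) = ∑ j ∈ T, |u j| := by
  simp [l1, Finset.sum_ite_mem, apply_ite (fun a : ℝ => |a|)]

lemma restr_add_compl (T : Finset (Fin p)) (u : Vec p) : restr T u + restr Tᶜ u = u := by
  ext j
  by_cases hj : j ∈ T <;> simp [hj]

lemma l1_restr_add_compl (T : Finset (Fin p)) (u : Vec p) :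
    l1 (restr T u) + l1 (restr Tᶜ u) = l1 u := by
  rw [l1_restr, l1_restr, Finset.sum_add_sum_compl, l1]

lemma norm_le_of_abs_le {T : Finset (Fin p)} {u : Vec p} {m : ℝ} {s : ℕ} (hu : u ∈ supportedOn T)
    (hT : T.card ≤ s) (hm : 0 ≤ m) (h : ∀ j, |u j| ≤ m) : ‖u‖ ≤ √(s : ℝ) * m := by
  apply le_of_sq_le_sq _ (by positivity)
  rw [mul_pow, Real.sq_sqrt (Nat.cast_nonneg _), EuclideanSpace.norm_sq_eq]
  calc ∑ j, ‖u j‖ ^ 2 = ∑ j ∈ T, ‖u j‖ ^ 2 := by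
        refine (Finset.sum_subset (Finset.subset_univ _) fun j _ hj => ?_).symm
        rw [hu j hj]
        simp
    _ ≤ ∑ _j ∈ T, m ^ 2 := by
        refine Finset.sum_le_sum fun j _ => ?_
        rw [Real.norm_eq_abs]
        gcongr
        exact h j
    _ = T.card * m ^ 2 := by simp
    _ ≤ s * m ^ 2 := by gcongr

lemma exists_top (u : Vec p) (U : Finset (Fin p)) (k : ℕ) (hk : k ≤ U.card) :
    ∃ T ⊆ U, T.card = k ∧ ∀ i ∈ T, ∀ j ∈ U \ T, |u j| ≤ |u i| := by
  induction k with
  | zero => exact ⟨∅, by simp, by simp, by simp⟩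
  | succ k ih =>
    obtain ⟨T, hTU, hTk, hT⟩ := ih (by omega)
    have hne : (U \ T).Nonempty := by
      rw [← Finset.card_pos, Finset.card_sdiff_of_subset hTU]
      omega
    obtain ⟨m, hm, hmax⟩ := Finset.exists_max_image (U \ T) (fun j => |u j|) hne
    have hm' := Finset.mem_sdiff.1 hm
    refine ⟨insert m T, Finset.insert_subset hm'.1 hTU, by rw [Finset.card_insert_of_notMem hm'.2,
      hTk], fun i hi j hj => ?_⟩
    have hj' : j ∈ U \ T := by
      simp only [Finset.mem_sdiff, Finset.mem_insert, not_or] at hj ⊢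
      exact ⟨hj.1, hj.2.2⟩
    rcases Finset.mem_insert.1 hi with rfl | hi
    · exact hmax j hj'
    · exact hT i hi j hj'

/-- The coordinates outside the `s` largest ones are bounded by the average of the latter. -/
lemma abs_restr_compl_le {u : Vec p} {U T : Finset (Fin p)} {s : ℕ} (hs : 0 < s)
    (hu : u ∈ supportedOn U) (hT : T.card = s) (h : ∀ i ∈ T, ∀ j ∈ U \ T, |u j| ≤ |u i|)
    (j : Fin p) : |restr Tᶜ u j| ≤ l1 (restr T u) / s := by
  have hs' : (0 : ℝ) < s := by exact_mod_cast hs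
  rw [restr_apply]
  split_ifs with hj
  · by_cases hjU : j ∈ U
    · rw [le_div_iff₀ hs', l1_restr, mul_comm, ← hT, ← nsmul_eq_mul]
      exact Finset.card_nsmul_le_sum _ _ _ fun i hi =>
        h i hi j (Finset.mem_sdiff.2 ⟨hjU, Finset.mem_compl.1 hj⟩)
    · rw [hu j hjU, abs_zero]
      exact div_nonneg (l1_nonneg _) hs'.le
  · rw [abs_zero]
    exact div_nonneg (l1_nonneg _) hs'.le

variable {F : Vec p → ℝ} {s : ℕ} {a : ℝ}

/-- Peel off the `s` largest entries repeatedly. The entries of a chunk are at most the average of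
the preceding chunk, so its Euclidean norm is at most the ℓ₁ norm of that chunk over √s, and these
add up to at most ‖u‖₁/√s. In the induction `m` bounds the entries of the chunk to be removed next.
-/
lemma le_of_subadditive_of_bounded (hF : ∀ u v, F (u + v) ≤ F u + F v) (hs : 0 < s) (ha : 0 ≤ a)
    (h : ∀ T : Finset (Fin p), T.card ≤ s → ∀ u ∈ supportedOn T, F u ≤ a * ‖u‖)
    (n : ℕ) : ∀ (U : Finset (Fin p)), U.card ≤ n → ∀ u ∈ supportedOn U, ∀ m : ℝ, 0 ≤ m →
      (∀ j, |u j| ≤ m) → F u ≤ a * (√(s : ℝ) * m + l1 u / √(s : ℝ)) := by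
  have hsq : 0 < √(s : ℝ) := Real.sqrt_pos.2 (by exact_mod_cast hs)
  induction n with
  | zero =>
    intro U hU u hu m hm hb
    refine (h U (by omega) u hu).trans ?_
    gcongr
    exact (norm_le_of_abs_le hu (hU.trans (Nat.zero_le _)) hm hb).trans
      (le_add_of_nonneg_right (div_nonneg (l1_nonneg _) hsq.le))
  | succ n ih =>
    intro U hU u hu m hm hb
    rcases le_or_gt U.card s with hUs | hUs
    · refine (h U hUs u hu).trans ?_
      gcongr
      exact (norm_le_of_abs_le hu hUs hm hb).trans
        (le_add_of_nonneg_right (div_nonneg (l1_nonneg _) hsq.le))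
    · obtain ⟨T, hTU, hTs, hT⟩ := exists_top u U s hUs.le
      have h1 : F (restr T u) ≤ a * (√(s : ℝ) * m) := by
        refine (h T hTs.le _ (restr_mem T u)).trans ?_
        gcongr
        refine norm_le_of_abs_le (restr_mem T u) hTs.le hm fun j => ?_
        rw [restr_apply]
        split_ifs
        · exact hb j
        · simpa using hm
      have h2 : F (restr Tᶜ u) ≤ a * (√(s : ℝ) * (l1 (restr T u) / s) +
          l1 (restr Tᶜ u) / √(s : ℝ)) := by
        refine ih (U \ T) ?_ _ ?_ _ (div_nonneg (l1_nonneg _) (Nat.cast_nonneg _))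
          (abs_restr_compl_le hs hu hTs hT)
        · rw [Finset.card_sdiff_of_subset hTU]
          omega
        · intro j hj
          by_cases hjT : j ∈ T
          · simp [hjT]
          · have : j ∉ U := fun hjU => hj (Finset.mem_sdiff.2 ⟨hjU, hjT⟩)
            simp [hjT, hu j this]
      have h3 : √(s : ℝ) * (l1 (restr T u) / s) = l1 (restr T u) / √(s : ℝ) := by
        have : (s : ℝ) = √(s : ℝ) * √(s : ℝ) := (Real.mul_self_sqrt (Nat.cast_nonneg _)).symm
        nth_rewrite 2 [this]
        field_simp
      rw [h3, ← add_div, l1_restr_add_compl] at h2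
      have h4 := hF (restr T u) (restr Tᶜ u)
      rw [restr_add_compl] at h4
      linarith

/-- A subadditive function bounded by the Euclidean norm on `s`-sparse vectors is bounded by the
mixed norm everywhere. -/
lemma le_mixedNorm_of_subadditive (hF : ∀ u v, F (u + v) ≤ F u + F v) (hs : 0 < s) (ha : 0 ≤ a)
    (h : ∀ T : Finset (Fin p), T.card ≤ s → ∀ u ∈ supportedOn T, F u ≤ a * ‖u‖) (u : Vec p) :
    F u ≤ a * mixedNorm s u := by
  have hsq : 0 < √(s : ℝ) := Real.sqrt_pos.2 (by exact_mod_cast hs)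
  have hu : u ∈ supportedOn (Finset.univ : Finset (Fin p)) := fun j hj => by simp at hj
  rcases le_or_gt (Finset.univ : Finset (Fin p)).card s with hp | hp
  · refine (h _ hp u hu).trans ?_
    gcongr
    exact norm_le_mixedNorm s u
  · obtain ⟨T, hTU, hTs, hT⟩ := exists_top u Finset.univ s hp.le
    have h1 : F (restr T u) ≤ a * ‖u‖ := by
      refine (h T hTs.le _ (restr_mem T u)).trans ?_
      gcongr
      exact norm_restr_le T u
    have h2 := le_of_subadditive_of_bounded hF hs ha h _ Tᶜ le_rfl _ (restr_mem Tᶜ u) _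
      (div_nonneg (l1_nonneg _) (Nat.cast_nonneg _)) (abs_restr_compl_le hs hu hTs hT)
    have h3 : √(s : ℝ) * (l1 (restr T u) / s) = l1 (restr T u) / √(s : ℝ) := by
      have : (s : ℝ) = √(s : ℝ) * √(s : ℝ) := (Real.mul_self_sqrt (Nat.cast_nonneg _)).symm
      nth_rewrite 2 [this]
      field_simp
    rw [h3, ← add_div, l1_restr_add_compl] at h2
    have h4 := hF (restr T u) (restr Tᶜ u)
    rw [restr_add_compl] at h4
    rw [mixedNorm]
    linarith

/-- A symmetric form small on `2s`-sparse vectors is small in the mixed norm. -/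
lemma abs_bil_le_mixedNorm {Δ : Matrix (Fin p) (Fin p) ℝ} (hΔ : Δ.IsSymm) (hs : 0 < s)
    (ha : 0 ≤ a) (h : ∀ T : Finset (Fin p), T.card ≤ 2 * s → ∀ u ∈ supportedOn T,
      |bil Δ u u| ≤ a * ‖u‖ ^ 2) (u v : Vec p) :
    |bil Δ u v| ≤ a * (mixedNorm s u * mixedNorm s v) := by
  -- Peeling is applied to one argument at a time; two `s`-sparse vectors share a support of size
  -- 2s, where polarization applies.
  have h1 : ∀ T : Finset (Fin p), T.card ≤ s → ∀ v ∈ supportedOn T, ∀ u : Vec p,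
      |bil Δ u v| ≤ a * ‖v‖ * mixedNorm s u := by
    intro T hT v hv u
    refine le_mixedNorm_of_subadditive (F := fun u => |bil Δ u v|) (fun u w => ?_) hs
      (by positivity) (fun U hU u hu => ?_) u
    · simpa using abs_add_le (bil Δ u v) (bil Δ w v)
    · have hc : (T ∪ U).card ≤ 2 * s := (Finset.card_union_le _ _).trans (by omega)
      have := abs_bil_le_of_abs_quad_le hΔ (supportedOn (T ∪ U)) (h _ hc)
        (supportedOn_mono Finset.subset_union_right hu)
        (supportedOn_mono Finset.subset_union_left hv)
      linarith
  have h2 := le_mixedNorm_of_subadditive (F := fun v => |bil Δ u v|) (s := s)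
    (a := a * mixedNorm s u) (fun v w => by simpa using abs_add_le (bil Δ u v) (bil Δ u w)) hs
    (mul_nonneg ha (mixedNorm_nonneg _ _)) (fun T hT v hv => by
      have := h1 T hT v hv u
      linarith) v
  linarith

end Sparse

/-! ### A grid of sparse vectors. -/

section Net

open Classical in
/-- Vectors with at most `k` nonzero coordinates, all of them in `{-1, …, 1}` with mesh `1 / m`. -/
def net (p m : ℕ) : ℕ → Finset (Vec p)
  | 0 => {0}
  | k + 1 => (net p m k ×ˢ (Finset.univ : Finset (Fin p × Fin (2 * m + 1)))).image fun q =>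
      q.1 + ((((q.2.2 : ℕ) : ℝ) - m) / m) • EuclideanSpace.single q.2.1 (1 : ℝ)

lemma card_net_le (p m k : ℕ) : (net p m k).card ≤ (p * (2 * m + 1)) ^ k := by
  induction k with
  | zero => simp [net]
  | succ k ih =>
    rw [net, pow_succ]
    refine Finset.card_image_le.trans ?_
    rw [Finset.card_product, Finset.card_univ, Fintype.card_prod, Fintype.card_fin,
      Fintype.card_fin]
    gcongr

variable {p : ℕ}

/-- The recursion may hit a coordinate more than once and so produce further vectors. This is
harmless: only this inclusion and the cardinality bound are used. -/
lemma mem_net {m : ℕ} (hp : 0 < p) (k : ℕ) : ∀ (T : Finset (Fin p)), T.card ≤ k →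
    ∀ v ∈ supportedOn T, (∀ j, ∃ a : ℤ, |a| ≤ m ∧ v j = a / m) → v ∈ net p m k := by
  induction k with
  | zero =>
    intro T hT v hv _
    have hT' : T = ∅ := by simpa using hT
    have : v = 0 := by
      ext j
      exact hv j (by simp [hT'])
    simp [net, this]
  | succ k ih =>
    intro T hT v hv hgrid
    obtain ⟨j, hj⟩ : ∃ j : Fin p, (T.erase j).card ≤ k := by
      rcases T.eq_empty_or_nonempty with rfl | ⟨j, hj⟩
      · exact ⟨⟨0, hp⟩, by simp⟩
      · exact ⟨j, by rw [Finset.card_erase_of_mem hj]; omega⟩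
    obtain ⟨a, ha, hva⟩ := hgrid j
    have hmem : restr (Finset.univ.erase j) v ∈ net p m k := by
      refine ih (T.erase j) hj _ (fun i hi => ?_) fun i => ?_
      · by_cases hij : i = j
        · simp [hij]
        · have : i ∉ T := fun h => hi (Finset.mem_erase.2 ⟨hij, h⟩)
          simp [hij, hv i this]
      · by_cases hij : i = j
        · exact ⟨0, by simp, by simp [hij]⟩
        · simpa [hij] using hgrid i
    rw [abs_le] at ha
    have hlt : (a + m).toNat < 2 * m + 1 := by omega
    rw [net, Finset.mem_image]
    refine ⟨(restr (Finset.univ.erase j) v, (j, ⟨(a + m).toNat, hlt⟩)), by simp [hmem], ?_⟩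
    have hcast : (((a + m).toNat : ℕ) : ℝ) - m = a := by
      have h1 : (((a + m).toNat : ℕ) : ℤ) = a + m := Int.toNat_of_nonneg (by omega)
      have h2 : (((a + m).toNat : ℕ) : ℝ) = ((a + m : ℤ) : ℝ) := by exact_mod_cast h1
      rw [h2]
      push_cast
      ring
    ext i
    by_cases hij : i = j
    · subst hij
      simp [hcast, hva]
    · simp [hij]

/-- Rounding each coordinate to mesh 1/(2k) preserves the support and moves a coordinate by at most
1/(4k), hence the vector by at most √k/(4k) ≤ 1/4. -/
lemma exists_net_close {k : ℕ} (hk : 0 < k) (hp : 0 < p) {T : Finset (Fin p)} (hT : T.card ≤ k)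
    {u : Vec p} (hu : u ∈ supportedOn T) (hu1 : ‖u‖ = 1) :
    ∃ v ∈ net p (2 * k) k, v ∈ supportedOn T ∧ ‖u - v‖ ≤ 1 / 4 := by
  set m : ℕ := 2 * k with hm
  have hm0 : (0 : ℝ) < m := by
    have : 0 < m := by omega
    exact_mod_cast this
  set v : Vec p := WithLp.toLp 2 fun j => (round ((m : ℝ) * u j) : ℝ) / m with hv
  have hvT : v ∈ supportedOn T := fun j hj => by simp [hv, hu j hj]
  refine ⟨v, mem_net hp k T hT v hvT fun j => ⟨round ((m : ℝ) * u j), ?_, rfl⟩, hvT, ?_⟩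
  · have h1 : |u j| ≤ 1 := by
      rw [← hu1, ← Real.norm_eq_abs]
      exact PiLp.norm_apply_le u j
    have h2 := abs_sub_round ((m : ℝ) * u j)
    have h3 : |(m : ℝ) * u j| ≤ m := by
      rw [abs_mul, abs_of_pos hm0]
      nlinarith
    have h4 : |((round ((m : ℝ) * u j) : ℤ) : ℝ)| < m + 1 := by
      rw [abs_le] at h2 h3
      rw [abs_lt]
      constructor <;> linarith
    have h5 : |round ((m : ℝ) * u j)| < (m : ℤ) + 1 := by exact_mod_cast h4
    omega
  · have h1 : ∀ j, |(u - v) j| ≤ 1 / (2 * m) := by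
      intro j
      have h2 := abs_sub_round ((m : ℝ) * u j)
      have h3 : (u - v) j = ((m : ℝ) * u j - round ((m : ℝ) * u j)) / m := by
        simp only [PiLp.sub_apply, hv]
        field_simp
      rw [h3, abs_div, abs_of_pos hm0, div_le_iff₀ hm0]
      refine h2.trans (le_of_eq ?_)
      field_simp
    have hk' : (0 : ℝ) < k := by exact_mod_cast hk
    refine (norm_le_of_abs_le ((supportedOn T).sub_mem hu hvT) hT (by positivity) h1).trans ?_
    have hmk : (m : ℝ) = 2 * k := by rw [hm]; push_cast; ring
    have hkk : √(k : ℝ) ≤ k := by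
      rw [Real.sqrt_le_left hk'.le]
      have : (1 : ℝ) ≤ k := by exact_mod_cast hk
      nlinarith
    rw [hmk, mul_one_div, div_le_iff₀ (by positivity)]
    linarith

lemma continuous_bil_self (S : Matrix (Fin p) (Fin p) ℝ) :
    Continuous fun u : Vec p => bil S u u := by
  simp only [bil_eq_sum]
  fun_prop

/-- Relative deviations on the net control the form on all vectors with a given support. -/
lemma abs_quad_le_of_net {Δ S : Matrix (Fin p) (Fin p) ℝ} (hΔ : Δ.IsSymm) {k : ℕ} (hk : 0 < k)
    (hp : 0 < p) {t B : ℝ} (ht : 0 ≤ t) (hB : 0 ≤ B)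
    (hnet : ∀ v ∈ net p (2 * k) k, |bil Δ v v| ≤ t * bil S v v) {T : Finset (Fin p)}
    (hT : T.card ≤ k) (hS : ∀ u ∈ supportedOn T, bil S u u ≤ B * ‖u‖ ^ 2) :
    ∀ u ∈ supportedOn T, |bil Δ u u| ≤ 4 * t * B * ‖u‖ ^ 2 := by
  intro u hu
  rcases eq_or_ne u 0 with rfl | hu0
  · simp
  have hun : 0 < ‖u‖ := norm_pos_iff.2 hu0
  have hscale : ∀ w ∈ supportedOn T, w ≠ 0 → ∃ z ∈ supportedOn T, ‖z‖ = 1 ∧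
      |bil Δ w w| = |bil Δ z z| * ‖w‖ ^ 2 := by
    intro w hw hw0
    have hwn : 0 < ‖w‖ := norm_pos_iff.2 hw0
    refine ⟨‖w‖⁻¹ • w, (supportedOn T).smul_mem _ hw, ?_, ?_⟩
    · rw [norm_smul, norm_inv, norm_norm, inv_mul_cancel₀ hwn.ne']
    · rw [bil_smul_left, bil_smul_right, abs_mul, abs_mul, abs_of_pos (inv_pos.2 hwn)]
      field_simp
  have hcpt : IsCompact (Metric.sphere (0 : Vec p) 1 ∩ (supportedOn T : Set (Vec p))) :=
    (isCompact_sphere 0 1).inter_right (supportedOn T).closed_of_finiteDimensional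
  obtain ⟨z, hz, hz1, -⟩ := hscale u hu hu0
  obtain ⟨z₀, ⟨hz₀1, hz₀T⟩, hmax⟩ := hcpt.exists_isMaxOn ⟨z, by simpa using hz1, hz⟩
    (continuous_bil_self Δ).abs.continuousOn
  have hz₀1' : ‖z₀‖ = 1 := by simpa using hz₀1
  set α := |bil Δ z₀ z₀| with hα
  have hα0 : 0 ≤ α := abs_nonneg _
  have hquad : ∀ w ∈ supportedOn T, |bil Δ w w| ≤ α * ‖w‖ ^ 2 := by
    intro w hw
    rcases eq_or_ne w 0 with rfl | hw0
    · simp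
    obtain ⟨z, hz, hz1, he⟩ := hscale w hw hw0
    rw [he]
    gcongr
    exact hmax ⟨by simpa using hz1, hz⟩
  obtain ⟨v, hvnet, hvT, hvc⟩ := exists_net_close hk hp hT hz₀T hz₀1'
  have hvn : ‖v‖ ≤ 5 / 4 := by
    have : v = z₀ - (z₀ - v) := by simp
    rw [this]
    exact (norm_sub_le _ _).trans (by linarith)
  have hsum : ‖z₀ + v‖ ≤ 9 / 4 := (norm_add_le _ _).trans (by linarith)
  have hdiff : |bil Δ z₀ z₀ - bil Δ v v| ≤ α * (1 / 4 * (9 / 4)) := by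
    have e1 : bil Δ z₀ z₀ - bil Δ v v = bil Δ (z₀ - v) (z₀ + v) := by
      simp only [bil_sub_left, bil_add_right, bil_comm hΔ (u := v) (v := z₀)]
      ring
    rw [e1]
    refine (abs_bil_le_of_abs_quad_le hΔ (supportedOn T) hquad ((supportedOn T).sub_mem hz₀T hvT)
      ((supportedOn T).add_mem hz₀T hvT)).trans ?_
    gcongr
  have hv2 : |bil Δ v v| ≤ t * (B * (5 / 4) ^ 2) := by
    refine (hnet v hvnet).trans ?_
    gcongr
    exact (hS v hvT).trans (by gcongr)
  -- The maximum α satisfies α ≤ (9/16) α + (25/16) t B, and 25/7 ≤ 4.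
  have hαle : α ≤ 4 * t * B := by
    have h1 : α ≤ |bil Δ z₀ z₀ - bil Δ v v| + |bil Δ v v| := by
      have := abs_add_le (bil Δ z₀ z₀ - bil Δ v v) (bil Δ v v)
      rwa [sub_add_cancel] at this
    have h2 : 0 ≤ t * B := by positivity
    linarith
  exact (hquad u hu).trans (by gcongr)

end Net

/-! ### Block-diagonal parts and closeness in the mixed norm. -/

section Blocks

variable {p D : ℕ} (blk : Fin p → Fin D) (S : Matrix (Fin p) (Fin p) ℝ)

/-- The features in block `d`. -/
def block (d : Fin D) : Finset (Fin p) := Finset.univ.filter fun j => blk j = d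

@[simp] lemma mem_block {d : Fin D} {j : Fin p} : j ∈ block blk d ↔ blk j = d := by simp [block]

lemma bil_blockPart (u v : Vec p) :
    bil (blockPart blk S) u v = ∑ d, bil S (restr (block blk d) u) (restr (block blk d) v) := by
  simp only [bil_eq_sum, blockPart, Matrix.of_apply, restr_apply, mem_block]
  rw [Finset.sum_comm]
  conv_rhs => rw [Finset.sum_comm]
  rw [Finset.sum_comm]
  refine Finset.sum_congr rfl fun i _ => ?_
  rw [Finset.sum_comm]
  refine Finset.sum_congr rfl fun j _ => ?_
  rw [Finset.sum_eq_single (blk i)]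
  · by_cases h : blk i = blk j
    · simp [h]
    · simp [h, Ne.symm h]
  · intro d _ hd
    simp [Ne.symm hd]
  · simp

lemma sum_norm_sq_restr_block (u : Vec p) : ∑ d, ‖restr (block blk d) u‖ ^ 2 = ‖u‖ ^ 2 := by
  simp_rw [norm_sq_restr, EuclideanSpace.norm_sq_eq, Real.norm_eq_abs, sq_abs, block]
  exact Finset.sum_fiberwise Finset.univ blk fun j => u j ^ 2

lemma restr_block_restr_block (d d' : Fin D) (u : Vec p) :
    restr (block blk d') (restr (block blk d) u) = if d' = d then restr (block blk d) u else 0 := by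
  ext j
  split_ifs with h
  · subst h
    by_cases hj : blk j = d' <;> simp [hj]
  · simp only [restr_apply, mem_block, PiLp.zero_apply]
    split_ifs with h1 h2
    · exact absurd (h1.symm.trans h2) h
    · rfl
    · rfl

lemma restr_of_mem {T : Finset (Fin p)} {u : Vec p} (hu : u ∈ supportedOn T) : restr T u = u := by
  ext j
  by_cases hj : j ∈ T
  · simp [hj]
  · simp [hj, hu j hj]

lemma bil_blockPart_of_mem {d : Fin D} {u : Vec p} (hu : u ∈ supportedOn (block blk d)) :
    bil (blockPart blk S) u u = bil S u u := by
  rw [bil_blockPart]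
  rw [← restr_of_mem hu]
  simp only [restr_block_restr_block]
  rw [Finset.sum_eq_single d]
  · simp
  · intro d' _ h
    simp [h]
  · simp

variable {blk S}

lemma isSymm_blockPart (hS : S.IsSymm) : (blockPart blk S).IsSymm := by
  ext i j
  simp only [Matrix.transpose_apply, blockPart, Matrix.of_apply, hS.apply i j, eq_comm]

/-- Relative deviations on the net control all deviations in the mixed norm. -/
lemma isClose_of_net {Sh : Matrix (Fin p) (Fin p) ℝ} (hS : S.IsSymm) (hSh : Sh.IsSymm) {s : ℕ}
    (hs : 0 < s) (hp : 0 < p) {t r M : ℝ} (ht : 0 ≤ t) (hr : 0 ≤ r) (hM : 0 ≤ M)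
    (hnet : ∀ v ∈ net p (2 * (2 * s)) (2 * s), |bil Sh v v - bil S v v| ≤ t * bil S v v)
    (hup : ∀ u : Vec p, bil S u u ≤ r * M * ‖u‖ ^ 2)
    (hblk : ∀ u : Vec p, bil (blockPart blk S) u u ≤ M * ‖u‖ ^ 2) :
    IsClose S (blockPart blk S) Sh (blockPart blk Sh) s r (4 * M * t) := by
  have hnet' : ∀ v ∈ net p (2 * (2 * s)) (2 * s), |bil (Sh - S) v v| ≤ t * bil S v v := by
    intro v hv
    rw [bil_matrix_sub]
    exact hnet v hv
  have hsym : (Sh - S).IsSymm := hSh.sub hS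
  have hsub : blockPart blk Sh - blockPart blk S = blockPart blk (Sh - S) := by
    ext i j
    simp only [blockPart, Matrix.sub_apply, Matrix.of_apply]
    split_ifs <;> simp
  constructor
  · intro u v
    rw [← bil_matrix_sub]
    refine (abs_bil_le_mixedNorm (a := 4 * t * (r * M)) hsym hs (by positivity)
      (fun T hT => ?_) u v).trans (le_of_eq (by ring))
    exact abs_quad_le_of_net hsym (by omega) hp ht (by positivity) hnet' hT fun u _ => hup u
  · intro u v
    rw [← bil_matrix_sub, hsub]
    refine (abs_bil_le_mixedNorm (a := 4 * t * M) (isSymm_blockPart hsym) hs (by positivity)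
      (fun T hT w hw => ?_) u v).trans (le_of_eq (by ring))
    -- Within a block the form of `S` is that of its block part, bounded by M rather than r M.
    -- Relative deviations on the net therefore give an error without the factor r.
    rw [bil_blockPart, ← sum_norm_sq_restr_block blk w, Finset.mul_sum]
    refine (Finset.abs_sum_le_sum_abs _ _).trans (Finset.sum_le_sum fun d _ => ?_)
    refine abs_quad_le_of_net (T := T ∩ block blk d) hsym (by omega) hp ht hM hnet'
      ((Finset.card_le_card Finset.inter_subset_left).trans hT) (fun u hu => ?_) _ fun j hj => ?_
    · rw [← bil_blockPart_of_mem blk S (supportedOn_mono Finset.inter_subset_right hu)]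
      exact hblk u
    · rw [restr_apply]
      split_ifs with h
      · exact hw j fun hjT => hj (Finset.mem_inter.2 ⟨hjT, h⟩)
      · rfl

end Blocks

/-! ### Consequences of the population assumptions. -/

section Population

lemma dotProduct_mulVec_bounds {n : Type*} [Fintype n] [DecidableEq n] {A : Matrix n n ℝ}
    (hA : A.IsHermitian) {a b : ℝ} (h : spectrum ℝ A ⊆ Set.Icc a b) (w : n → ℝ) :
    a * (w ⬝ᵥ w) ≤ w ⬝ᵥ A.mulVec w ∧ w ⬝ᵥ A.mulVec w ≤ b * (w ⬝ᵥ w) := by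
  have hscal : ∀ c : ℝ, (algebraMap ℝ (Matrix n n ℝ) c).IsHermitian := by
    intro c
    rw [Matrix.algebraMap_eq_diagonal]
    exact Matrix.isHermitian_diagonal _
  have hmul : ∀ c : ℝ, w ⬝ᵥ (algebraMap ℝ (Matrix n n ℝ) c).mulVec w = c * (w ⬝ᵥ w) := by
    intro c
    rw [Algebra.algebraMap_eq_smul_one, Matrix.smul_mulVec, Matrix.one_mulVec, dotProduct_smul,
      smul_eq_mul]
  constructor
  · have h1 : (A - algebraMap ℝ (Matrix n n ℝ) a).PosSemidef := by
      rw [Matrix.posSemidef_iff_isHermitian_and_spectrum_nonneg]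
      refine ⟨hA.sub (hscal a), ?_⟩
      rw [← spectrum.sub_singleton_eq]
      rintro _ ⟨x, hx, y, rfl, rfl⟩
      exact sub_nonneg.2 (h hx).1
    have h2 := h1.dotProduct_mulVec_nonneg w
    rw [star_trivial, Matrix.sub_mulVec, dotProduct_sub, hmul] at h2
    linarith
  · have h1 : (algebraMap ℝ (Matrix n n ℝ) b - A).PosSemidef := by
      rw [Matrix.posSemidef_iff_isHermitian_and_spectrum_nonneg]
      refine ⟨(hscal b).sub hA, ?_⟩
      rw [← spectrum.singleton_sub_eq]
      rintro _ ⟨y, rfl, x, hx, rfl⟩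
      exact sub_nonneg.2 (h hx).2
    have h2 := h1.dotProduct_mulVec_nonneg w
    rw [star_trivial, Matrix.sub_mulVec, dotProduct_sub, hmul] at h2
    linarith

variable {p D : ℕ} {blk : Fin p → Fin D} {S : Matrix (Fin p) (Fin p) ℝ}

lemma sum_block_eq (d : Fin D) (f : Fin p → ℝ) :
    ∑ j ∈ block blk d, f j = ∑ j : {j : Fin p // blk j = d}, f j :=
  (Finset.sum_subtype _ (by simp) f)

lemma bil_restr_block (d : Fin D) (u : Vec p) :
    bil S (restr (block blk d) u) (restr (block blk d) u) =
      (fun j : {j : Fin p // blk j = d} => u j) ⬝ᵥ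
        (blockOf blk S d).mulVec (fun j : {j : Fin p // blk j = d} => u j) := by
  have h1 : ∀ (f : Fin p → ℝ), ∑ j, (if blk j = d then f j else 0) =
      ∑ j : {j : Fin p // blk j = d}, f j := by
    intro f
    rw [← sum_block_eq, block, Finset.sum_filter]
  simp only [bil_eq_sum, restr_apply, mem_block, dotProduct, Matrix.mulVec, blockOf,
    Matrix.submatrix_apply, Finset.mul_sum]
  rw [← h1 fun i => ∑ j : {j : Fin p // blk j = d}, u i * (S i j * u j)]
  refine Finset.sum_congr rfl fun i _ => ?_
  rw [← h1 fun j => u i * (S i j * u j)]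
  split_ifs with hi
  · refine Finset.sum_congr rfl fun j _ => ?_
    split_ifs <;> ring
  · simp

lemma norm_sq_restr_block (d : Fin D) (u : Vec p) : ‖restr (block blk d) u‖ ^ 2 =
    (fun j : {j : Fin p // blk j = d} => u j) ⬝ᵥ (fun j : {j : Fin p // blk j = d} => u j) := by
  rw [norm_sq_restr, sum_block_eq]
  simp only [dotProduct, pow_two]

lemma blockPart_bounds (hS : S.IsHermitian) {a b : ℝ}
    (h : ∀ d, spectrum ℝ (blockOf blk S d) ⊆ Set.Icc a b) (u : Vec p) :
    a * ‖u‖ ^ 2 ≤ bil (blockPart blk S) u u ∧ bil (blockPart blk S) u u ≤ b * ‖u‖ ^ 2 := by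
  have hd := fun d => dotProduct_mulVec_bounds (hS.submatrix (Subtype.val : {j // blk j = d} → _))
    (h d) (fun j : {j : Fin p // blk j = d} => u j)
  rw [bil_blockPart, ← sum_norm_sq_restr_block blk u, Finset.mul_sum, Finset.mul_sum]
  constructor <;> refine Finset.sum_le_sum fun d _ => ?_ <;>
    rw [bil_restr_block, norm_sq_restr_block]
  · exact (hd d).1
  · exact (hd d).2

lemma rayleigh_smul (L : Matrix (Fin p) (Fin p) ℝ) {c : ℝ} (hc : c ≠ 0) (u : Vec p) :
    rayleigh S L (c • u) = rayleigh S L u := by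
  simp only [rayleigh, quad_eq_bil, bil_smul_left, bil_smul_right]
  rw [mul_div_mul_left _ _ hc, mul_div_mul_left _ _ hc]

variable {ξ : ℕ → Vec p} {M γ C : ℝ}

/-- With a single feature the block part is all of `S` and the quotient is at most 1. Two features
are needed for `ξ 2` to be constrained. -/
lemma IsPopulation.two_le (h : IsPopulation blk S ξ M γ C) (hC : 0 < C) : 2 ≤ p := by
  by_contra hp
  have hlead := h.leading
  have : corr blk S ξ 1 ≤ 1 := by
    have hsub : ∀ i j : Fin p, i = j := fun i j => Fin.ext (by omega)
    have hbp : blockPart blk S = S := by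
      ext i j
      rw [hsub i j]
      simp [blockPart]
    rw [corr, hbp, rayleigh]
    exact div_self_le_one _
  linarith

lemma IsPopulation.isLeading (h : IsPopulation blk S ξ M γ C) (hM : 0 < M) (hC : 0 < C) :
    IsLeading S (blockPart blk S) (ξ 1) (corr blk S ξ 1) M γ := by
  have hp := h.two_le hC
  have hsym : S.IsSymm := by
    have := h.posSemidef.isHermitian
    rwa [Matrix.IsHermitian, Matrix.conjTranspose_eq_transpose_of_trivial] at this
  have hb := blockPart_bounds h.posSemidef.isHermitian h.block_spectrum
  have hlow : ∀ u : Vec p, ‖u‖ ^ 2 ≤ M * bil (blockPart blk S) u u := by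
    intro u
    have := mul_le_mul_of_nonneg_left (hb u).1 hM.le
    rwa [← mul_assoc, mul_one_div_cancel hM.ne', one_mul] at this
  have hpos : ∀ u : Vec p, u ≠ 0 → 0 < bil (blockPart blk S) u u := by
    intro u hu
    have h1 := hlow u
    have h2 : 0 < ‖u‖ ^ 2 := by have := norm_pos_iff.2 hu; positivity
    exact pos_of_mul_pos_right (h2.trans_le h1) hM.le
  have hnn : ∀ u : Vec p, 0 ≤ bil S u u := by
    intro u
    simpa [bil] using h.posSemidef.dotProduct_mulVec_nonneg u.ofLp
  obtain ⟨⟨hξ1, -⟩, hmax1⟩ := h.directions 1 (Finset.mem_Icc.2 ⟨le_rfl, by omega⟩)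
  obtain ⟨-, hmax2⟩ := h.directions 2 (Finset.mem_Icc.2 ⟨by omega, hp⟩)
  have hr : 0 < corr blk S ξ 1 := by linarith [h.leading]
  set r := corr blk S ξ 1 with hrdef
  set L := blockPart blk S with hL
  have hLs : L.IsSymm := isSymm_blockPart hsym
  have hunit : ∀ u : Vec p, u ≠ 0 → ‖(‖u‖⁻¹ • u)‖ = 1 := by
    intro u hu
    rw [norm_smul, norm_inv, norm_norm, inv_mul_cancel₀ (norm_ne_zero_iff.2 hu)]
  have hray : ∀ u : Vec p, u ≠ 0 → ∀ c : ℝ, rayleigh S L (‖u‖⁻¹ • u) ≤ c →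
      bil S u u ≤ c * bil L u u := by
    intro u hu c hc
    rw [rayleigh_smul _ (inv_ne_zero (norm_ne_zero_iff.2 hu)), rayleigh, quad_eq_bil, quad_eq_bil,
      div_le_iff₀ (hpos u hu)] at hc
    exact hc
  have htop : ∀ u : Vec p, 0 ≤ bil (r • L - S) u u := by
    intro u
    rw [bil_matrix_sub, bil_matrix_smul, sub_nonneg]
    rcases eq_or_ne u 0 with rfl | hu
    · simp
    · exact hray u hu r (hmax1 _ ⟨hunit u hu, by simp⟩)
  have hξ0 : ξ 1 ≠ 0 := fun h0 => by simp [h0] at hξ1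
  have hzero : bil (r • L - S) (ξ 1) (ξ 1) = 0 := by
    rw [bil_matrix_sub, bil_matrix_smul, hrdef, corr, rayleigh, quad_eq_bil, quad_eq_bil,
      div_mul_cancel₀ _ (hpos _ hξ0).ne', sub_self]
  refine ⟨hsym, hLs, hnn, hlow, fun u => (hb u).2, hξ1, hr, fun v => ?_, fun w hw => ?_⟩
  · have h1 := sq_bil_le ((hLs.smul r).sub hsym) htop v (ξ 1)
    rw [hzero, mul_zero] at h1
    have h2 : bil (r • L - S) v (ξ 1) = 0 := pow_eq_zero_iff two_ne_zero |>.1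
      (le_antisymm h1 (sq_nonneg _))
    rw [bil_matrix_sub, bil_matrix_smul] at h2
    linarith
  · rcases eq_or_ne w 0 with rfl | hw0
    · simp
    · have h1 : ‖w‖⁻¹ • w ∈ admissible L ξ 2 := by
        refine ⟨hunit w hw0, fun i hi => ?_⟩
        have : i = 1 := by
          have := Finset.mem_Ico.1 hi
          omega
        subst this
        have : bil L (‖w‖⁻¹ • w) (ξ 1) = 0 := by rw [bil_smul_left, hw, mul_zero]
        exact this
      refine hray w hw0 _ ((hmax2 _ h1).trans ?_)
      have := h.gap
      rw [corr] at this
      change _ ≤ _ - corr blk S ξ 2 at this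
      change corr blk S ξ 2 ≤ _
      rw [← corr] at this
      linarith

end Population

/-! ### Chernoff bound for averages of squared Gaussian variables. -/

section ChiSquare

open NNReal

lemma integral_exp_mul_sq_gaussianReal {v : ℝ≥0} (hv : v ≠ 0) {l : ℝ} (hl : 2 * l * v < 1) :
    ∫ y, Real.exp (l * y ^ 2) ∂(gaussianReal 0 v) = (√(1 - 2 * l * v))⁻¹ := by
  have hv0 : (0 : ℝ) < v := by
    have : 0 < v := pos_iff_ne_zero.2 hv
    exact_mod_cast this
  have hb : 0 < 1 - 2 * l * v := by linarith
  rw [integral_gaussianReal_eq_integral_smul hv]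
  have h1 : ∀ y : ℝ, gaussianPDFReal 0 v y • Real.exp (l * y ^ 2) =
      (√(2 * Real.pi * v))⁻¹ * Real.exp (-((1 - 2 * l * v) / (2 * v)) * y ^ 2) := by
    intro y
    rw [gaussianPDFReal, smul_eq_mul, mul_assoc, ← Real.exp_add]
    congr 2
    field_simp
    ring
  simp_rw [h1]
  rw [integral_const_mul, integral_gaussian, ← Real.sqrt_inv, ← Real.sqrt_inv,
    ← Real.sqrt_mul (by positivity)]
  congr 1
  field_simp

variable {Ω : Type*} [MeasurableSpace Ω] {P : Measure Ω}

lemma mgf_sq_of_hasLaw {Y : Ω → ℝ} {v : ℝ≥0} (hY : HasLaw Y (gaussianReal 0 v) P) (hv : v ≠ 0)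
    {l : ℝ} (hl : 2 * l * v < 1) : mgf (fun ω => Y ω ^ 2) P l = (√(1 - 2 * l * v))⁻¹ := by
  rw [← integral_exp_mul_sq_gaussianReal hv hl, mgf]
  exact hY.integral_comp (f := fun y => Real.exp (l * y ^ 2)) (by fun_prop)

lemma exp_le_one_sub {z : ℝ} (h0 : 0 ≤ z) (h1 : z ≤ 1 / 2) : Real.exp (-z - z ^ 2) ≤ 1 - z := by
  have h2 := Real.quadratic_le_exp_of_nonneg (show 0 ≤ z + z ^ 2 by positivity)
  have h3 : -z - z ^ 2 = -(z + z ^ 2) := by ring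
  rw [h3, Real.exp_neg, inv_le_iff_one_le_mul₀ (Real.exp_pos _)]
  have h4 : (1 + (z + z ^ 2) + (z + z ^ 2) ^ 2 / 2) * (1 - z) ≤
      Real.exp (z + z ^ 2) * (1 - z) := mul_le_mul_of_nonneg_right h2 (by linarith)
  have h5 : 0 ≤ z ^ 2 / 2 * (1 - z - z ^ 2 - z ^ 3) := by
    have h6 : z ^ 2 ≤ (1 / 2) ^ 2 := by gcongr
    have h7 : z ^ 3 ≤ (1 / 2) ^ 3 := by gcongr
    have : 0 ≤ 1 - z - z ^ 2 - z ^ 3 := by linarith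
    positivity
  linarith

lemma exp_le_one_add {z : ℝ} (h0 : 0 ≤ z) (h1 : z ≤ 1 / 2) : Real.exp (z - z ^ 2) ≤ 1 + z := by
  have hz : z ^ 2 ≤ z := by nlinarith
  have h2 := Real.abs_exp_sub_one_sub_id_le (x := z - z ^ 2) (by
    rw [abs_le]
    constructor <;> nlinarith)
  have h3 := (abs_le.1 h2).2
  have h4 : (z - z ^ 2) ^ 2 ≤ z ^ 2 := by
    apply pow_le_pow_left₀ (by linarith)
    nlinarith
  linarith

/-- Concentration of the average of squared centered Gaussian variables. -/
lemma measureReal_chiSquare_le [IsProbabilityMeasure P] {n : ℕ} (hn : 0 < n) {Y : Fin n → Ω → ℝ}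
    {v : ℝ≥0} (hY : ∀ i, HasLaw (Y i) (gaussianReal 0 v) P) (hind : iIndepFun Y P) {t : ℝ} (ht0 : 0 ≤ t)
    (ht1 : t ≤ 1) :
    P.real {ω | t * v < |(∑ i, Y i ω ^ 2) / n - v|} ≤ 2 * Real.exp (-(n * t ^ 2 / 8)) := by
  have hn' : (0 : ℝ) < n := by exact_mod_cast hn
  -- In the degenerate case Y vanishes almost surely, and the strict inequality makes the event
  -- null.
  rcases eq_or_ne v 0 with rfl | hv
  · have hae : ∀ᵐ ω ∂P, ∀ i, Y i ω = 0 := by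
      rw [ae_all_iff]
      intro i
      have := hY i
      rw [gaussianReal_zero_var] at this
      exact this.ae_eq_of_dirac
    have : P.real {ω | t * ((0 : ℝ≥0) : ℝ) < |(∑ i, Y i ω ^ 2) / n - ((0 : ℝ≥0) : ℝ)|} = 0 := by
      rw [measureReal_eq_zero_iff, measure_eq_zero_iff_ae_notMem]
      filter_upwards [hae] with ω hω
      simp [hω]
    rw [this]
    positivity
  have hv0 : (0 : ℝ) < v := by
    have : 0 < v := pos_iff_ne_zero.2 hv
    exact_mod_cast this
  have hsq : iIndepFun (fun i ω => Y i ω ^ 2) P := hind.comp (fun _ y => y ^ 2) (by fun_prop)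
  have hmeas : ∀ i, AEMeasurable (fun ω => Y i ω ^ 2) P := fun i => (hY i).aemeasurable.pow_const 2
  have hmgf : ∀ l : ℝ, 2 * l * v < 1 → mgf (∑ i, fun ω => Y i ω ^ 2) P l =
      (√(1 - 2 * l * v))⁻¹ ^ n := by
    intro l hl
    rw [hsq.mgf_sum₀ hmeas]
    simp_rw [fun i => mgf_sq_of_hasLaw (hY i) hv hl]
    simp
  have hbd : ∀ l : ℝ, 2 * l * v < 1 →
      Integrable (fun ω => Real.exp (l * (∑ i, fun ω => Y i ω ^ 2) ω)) P := by
    intro l hl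
    -- A non-integrable exponential would have moment generating function 0 by convention, but the
    -- computed value is positive.
    by_contra hni
    have h1 : mgf (∑ i, fun ω => Y i ω ^ 2) P l = 0 := integral_undef hni
    rw [hmgf l hl] at h1
    have : 0 < √(1 - 2 * l * v) := Real.sqrt_pos.2 (by linarith)
    have : 0 < (√(1 - 2 * l * v))⁻¹ ^ n := by positivity
    linarith
  have hbase : ∀ w x : ℝ, 0 < w → Real.exp (2 * x) ≤ w →
      Real.exp (n * x - n * t ^ 2 / 8) * (√w)⁻¹ ^ n ≤ Real.exp (-(n * t ^ 2 / 8)) := by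
    intro w x hw hx
    have hs : 0 < √w := Real.sqrt_pos.2 hw
    have h1 : Real.exp x ≤ √w := by
      rw [Real.le_sqrt' (Real.exp_pos _), ← Real.exp_nat_mul]
      exact_mod_cast hx
    have h2 : Real.exp (n * x) * (√w)⁻¹ ^ n ≤ 1 := by
      rw [Real.exp_nat_mul, ← mul_pow]
      exact pow_le_one₀ (by positivity) (by rwa [← div_eq_mul_inv, div_le_one hs])
    rw [sub_eq_add_neg, Real.exp_add]
    calc Real.exp (n * x) * Real.exp (-(n * t ^ 2 / 8)) * (√w)⁻¹ ^ n
        = Real.exp (n * x) * (√w)⁻¹ ^ n * Real.exp (-(n * t ^ 2 / 8)) := by ring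
      _ ≤ 1 * Real.exp (-(n * t ^ 2 / 8)) := by gcongr
      _ = _ := one_mul _
  have hup : P.real {ω | n * v * (1 + t) ≤ (∑ i, fun ω => Y i ω ^ 2) ω} ≤
      Real.exp (-(n * t ^ 2 / 8)) := by
    -- With parameter t/(4v) the exponent per observation is at most −t(1 + t)/4 + t/4 + t²/8 =
    -- −t²/8, using 1 − z ≥ exp(−z − z²) at z = t/2.
    have h2 : 2 * (t / (4 * v)) * v = t / 2 := by field_simp; ring
    refine (measure_ge_le_exp_mul_mgf _ (t := t / (4 * v)) (by positivity)
      (hbd _ (by rw [h2]; linarith))).trans ?_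
    rw [hmgf _ (by rw [h2]; linarith), h2]
    refine le_trans (le_of_eq ?_) (hbase (1 - t / 2) (-(t / 2) / 2 - (t / 2) ^ 2 / 2)
      (by linarith) ?_)
    · congr 2
      field_simp
      ring
    · refine le_trans (le_of_eq ?_) (exp_le_one_sub (z := t / 2) (by linarith) (by linarith))
      congr 1
      ring
  have hdn : P.real {ω | (∑ i, fun ω => Y i ω ^ 2) ω ≤ n * v * (1 - t)} ≤
      Real.exp (-(n * t ^ 2 / 8)) := by
    have h2 : 2 * (-(t / (4 * v))) * v = -(t / 2) := by field_simp; ring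
    refine (measure_le_le_exp_mul_mgf _ (t := -(t / (4 * v))) (by
      rw [neg_nonpos]; positivity) (hbd _ (by rw [h2]; linarith))).trans ?_
    rw [hmgf _ (by rw [h2]; linarith), h2]
    refine le_trans (le_of_eq ?_) (hbase (1 - -(t / 2)) ((t / 2) / 2 - (t / 2) ^ 2 / 2)
      (by linarith) ?_)
    · congr 2
      field_simp
      ring
    · rw [sub_neg_eq_add]
      refine le_trans (le_of_eq ?_) (exp_le_one_add (z := t / 2) (by linarith) (by linarith))
      congr 1
      ring
  have hsub : {ω | t * v < |(∑ i, Y i ω ^ 2) / n - v|} ⊆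
      {ω | n * v * (1 + t) ≤ (∑ i, fun ω => Y i ω ^ 2) ω} ∪
        {ω | (∑ i, fun ω => Y i ω ^ 2) ω ≤ n * v * (1 - t)} := by
    intro ω hω
    simp only [Set.mem_ofPred_eq, Set.mem_union, Finset.sum_apply] at hω ⊢
    rcases lt_abs.1 hω with h1 | h1
    · left
      have h2 : v * (1 + t) < (∑ i, Y i ω ^ 2) / n := by linarith
      rw [lt_div_iff₀ hn'] at h2
      linarith
    · right
      have h2 : (∑ i, Y i ω ^ 2) / n < v * (1 - t) := by linarith
      rw [div_lt_iff₀ hn'] at h2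
      linarith
  calc _ ≤ _ := measureReal_mono hsub
    _ ≤ _ := measureReal_union_le _ _
    _ ≤ _ := by linarith

end ChiSquare

/-! ### Deviations of the sample covariance on the net. -/

section SampleCovariance

variable {Ω : Type*} [MeasurableSpace Ω] {P : Measure Ω} {p : ℕ} {S : Matrix (Fin p) (Fin p) ℝ}

lemma hasLaw_inner {X : Ω → Vec p} (hS : S.PosSemidef)
    (hX : HasLaw X (multivariateGaussian 0 S) P) (v : Vec p) :
    HasLaw (fun ω => inner ℝ v (X ω)) (gaussianReal 0 (bil S v v).toNNReal) P := by
  have h1 : (multivariateGaussian 0 S).map (innerSL ℝ v) =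
      gaussianReal 0 (bil S v v).toNNReal := by
    rw [IsGaussian.map_eq_gaussianReal, ContinuousLinearMap.integral_comp_id_comm
      IsGaussian.integrable_id, integral_id_multivariateGaussian, map_zero]
    have h2 : covarianceBilin (multivariateGaussian 0 S) v v =
        Var[innerSL ℝ v; multivariateGaussian 0 S] := by
      rw [covarianceBilin_self IsGaussian.memLp_two_id]
      rfl
    rw [← h2, covarianceBilin_multivariateGaussian hS]
    rfl
  refine ⟨by have := hX.aemeasurable; fun_prop, ?_⟩
  rw [← h1, ← hX.map_eq, AEMeasurable.map_map_of_aemeasurable (by fun_prop) hX.aemeasurable]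
  rfl

lemma isSymm_sampleCov {n : ℕ} (x : Fin n → Vec p) : (sampleCov x).IsSymm := by
  ext i j
  simp only [Matrix.transpose_apply, sampleCov, Matrix.of_apply, mul_comm]

lemma bil_sampleCov {n : ℕ} (x : Fin n → Vec p) (v : Vec p) :
    bil (sampleCov x) v v = (∑ i, inner ℝ v (x i) ^ 2) / n := by
  have h1 : ∀ i, inner ℝ v (x i) ^ 2 = ∑ j, ∑ k, v j * (x i j * x i k) * v k := by
    intro i
    rw [pow_two, PiLp.inner_apply, Finset.sum_mul_sum]
    refine Finset.sum_congr rfl fun j _ => Finset.sum_congr rfl fun k _ => ?_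
    simp
    ring
  simp_rw [h1, bil_eq_sum, sampleCov, Matrix.of_apply]
  have h2 : ∑ i, ∑ j, ∑ k, v j * (x i j * x i k) * v k =
      ∑ j, ∑ k, ∑ i, v j * (x i j * x i k) * v k := by
    rw [Finset.sum_comm]
    exact Finset.sum_congr rfl fun j _ => Finset.sum_comm
  rw [h2, Finset.sum_div]
  refine Finset.sum_congr rfl fun j _ => ?_
  rw [Finset.sum_div]
  refine Finset.sum_congr rfl fun k _ => ?_
  rw [← Finset.sum_mul, ← Finset.mul_sum]
  ring

/-- With high probability the quadratic forms of the sample covariance matrix have small relative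
deviations on the net. -/
lemma measure_net_deviation_le [IsProbabilityMeasure P] {n : ℕ} (hn : 0 < n)
    {X : Fin n → Ω → Vec p} (hS : S.PosSemidef)
    (hX : ∀ i, HasLaw (X i) (multivariateGaussian 0 S) P) (hind : iIndepFun X P) {s : ℕ}
    (hs : 0 < s) (hsp : s ≤ p) (hp : 2 ≤ p) (ht : 11 * √(rate s p n) ≤ 1) :
    P.real {ω | ¬ ∀ v ∈ net p (2 * (2 * s)) (2 * s),
      |bil (sampleCov fun i => X i ω) v v - bil S v v| ≤ 11 * √(rate s p n) * bil S v v} ≤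
        2 / p := by
  have hp0 : (0 : ℝ) < p := by
    have : 0 < p := by omega
    exact_mod_cast this
  have hn' : (0 : ℝ) < n := by exact_mod_cast hn
  have hlog : 0 ≤ Real.log p := Real.log_natCast_nonneg p
  have hrate : 0 ≤ rate s p n := by unfold rate; positivity
  set t := 11 * √(rate s p n) with htdef
  have ht0 : 0 ≤ t := by positivity
  have hone : ∀ v : Vec p, P.real {ω | t * bil S v v <
      |bil (sampleCov fun i => X i ω) v v - bil S v v|} ≤ 2 * Real.exp (-(n * t ^ 2 / 8)) := by
    intro v
    have hv : 0 ≤ bil S v v := by simpa [bil] using hS.dotProduct_mulVec_nonneg v.ofLp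
    have hind' : iIndepFun (fun i ω => inner ℝ v (X i ω)) P :=
      hind.comp (fun _ y => inner ℝ v y) (by fun_prop)
    have := measureReal_chiSquare_le hn (fun i => hasLaw_inner hS (hX i) v) hind' ht0 ht
    rw [Real.coe_toNNReal _ hv] at this
    simpa only [bil_sampleCov] using this
  have hsub : {ω | ¬ ∀ v ∈ net p (2 * (2 * s)) (2 * s),
      |bil (sampleCov fun i => X i ω) v v - bil S v v| ≤ t * bil S v v} ⊆
      ⋃ v ∈ net p (2 * (2 * s)) (2 * s), {ω | t * bil S v v <
        |bil (sampleCov fun i => X i ω) v v - bil S v v|} := by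
    intro ω hω
    simp only [Set.mem_ofPred_eq, not_forall, not_le] at hω
    obtain ⟨v, hv, h⟩ := hω
    exact Set.mem_biUnion hv h
  have hcard : ((net p (2 * (2 * s)) (2 * s)).card : ℝ) ≤ Real.exp (12 * (s * Real.log p)) := by
    have h1 : (net p (2 * (2 * s)) (2 * s)).card ≤ p ^ (12 * s) := by
      refine (card_net_le _ _ _).trans ?_
      -- 8 s + 1 ≤ 16 p ≤ p⁵, because 1 ≤ s ≤ p and 2 ≤ p.
      have h2 : p * (2 * (2 * (2 * s)) + 1) ≤ p ^ 6 := by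
        have h3 : 2 ^ 4 ≤ p ^ 4 := Nat.pow_le_pow_left hp 4
        have h4 : 2 * (2 * (2 * s)) + 1 ≤ p ^ 4 * p :=
          le_trans (by omega) (Nat.mul_le_mul_right p h3)
        calc p * (2 * (2 * (2 * s)) + 1) ≤ p * (p ^ 4 * p) := Nat.mul_le_mul_left p h4
          _ = p ^ 6 := by ring
      calc _ ≤ (p ^ 6) ^ (2 * s) := Nat.pow_le_pow_left h2 _
        _ = p ^ (12 * s) := by rw [← pow_mul]; congr 1; ring
    have h5 : Real.exp (12 * (s * Real.log p)) = (p : ℝ) ^ (12 * s) := by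
      rw [← Real.exp_log (pow_pos hp0 (12 * s)), Real.log_pow]
      congr 1
      push_cast
      ring
    rw [h5]
    exact_mod_cast h1
  calc _ ≤ P.real (⋃ v ∈ net p (2 * (2 * s)) (2 * s), {ω | t * bil S v v <
        |bil (sampleCov fun i => X i ω) v v - bil S v v|}) :=
        measureReal_mono hsub (measure_ne_top _ _)
    _ ≤ ∑ v ∈ net p (2 * (2 * s)) (2 * s), P.real {ω | t * bil S v v <
        |bil (sampleCov fun i => X i ω) v v - bil S v v|} := measureReal_biUnion_finset_le _ _
    _ ≤ ∑ v ∈ net p (2 * (2 * s)) (2 * s), 2 * Real.exp (-(n * t ^ 2 / 8)) :=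
        Finset.sum_le_sum fun v _ => hone v
    _ = (net p (2 * (2 * s)) (2 * s)).card * (2 * Real.exp (-(n * t ^ 2 / 8))) := by
        rw [Finset.sum_const, nsmul_eq_mul]
    _ ≤ Real.exp (12 * (s * Real.log p)) * (2 * Real.exp (-(n * t ^ 2 / 8))) := by gcongr
    _ = 2 * Real.exp (12 * (s * Real.log p) - n * t ^ 2 / 8) := by
        rw [sub_eq_add_neg, Real.exp_add]
        ring
    _ ≤ 2 * Real.exp (-Real.log p) := by
        gcongr
        -- The constant 11 is chosen so that 121/8 exceeds the entropy 12 by more than 1.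
        have h6 : n * t ^ 2 = 121 * (s * Real.log p) := by
          rw [htdef, mul_pow, Real.sq_sqrt hrate, rate]
          field_simp
          ring
        have h7 : 1 * Real.log p ≤ s * Real.log p := by
          gcongr
          exact_mod_cast hs
        rw [h6]
        linarith
    _ = 2 / p := by rw [Real.exp_neg, Real.exp_log hp0, div_eq_mul_inv]

end SampleCovariance

/-! ### The shrinking ℓ₁ bounds and T*. -/

section Bounds

variable {cB₁ cB₂ η Linf : ℝ} {s p n : ℕ}

lemma bound_zero : bound cB₁ cB₂ η Linf s p n 0 = initBound cB₁ s := by simp [bound]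

lemma bound_le (h0 : 0 ≤ cB₂ * η * √(rate s p n)) (h1 : cB₂ * η * √(rate s p n) ≤ 1)
    (hL : Linf ≤ initBound cB₁ s) (t : ℕ) : bound cB₁ cB₂ η Linf s p n t ≤ initBound cB₁ s := by
  have h2 : (1 - cB₂ * η * √(rate s p n)) ^ t ≤ 1 := pow_le_one₀ (by linarith) (by linarith)
  have h3 := mul_le_mul_of_nonneg_right h2 (sub_nonneg.2 hL)
  rw [bound]
  linarith

lemma bound_le_succ_add (h0 : 0 ≤ cB₂ * η * √(rate s p n)) (h1 : cB₂ * η * √(rate s p n) ≤ 1)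
    (hL0 : 0 ≤ Linf) (hL : Linf ≤ initBound cB₁ s) (t : ℕ) :
    bound cB₁ cB₂ η Linf s p n t ≤
      bound cB₁ cB₂ η Linf s p n (t + 1) + cB₂ * η * √(rate s p n) * initBound cB₁ s := by
  set a := cB₂ * η * √(rate s p n) with ha
  have h2 : (1 - a) ^ t ≤ 1 := pow_le_one₀ (by linarith) (by linarith)
  have h3 : (1 - a) ^ t * (initBound cB₁ s - Linf) ≤ 1 * initBound cB₁ s :=
    mul_le_mul h2 (by linarith) (by linarith) zero_le_one
  have h4 := mul_le_mul_of_nonneg_left h3 h0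
  rw [bound, bound, ← ha, pow_succ]
  linarith

lemma tendsto_bound (h0 : 0 < cB₂ * η * √(rate s p n)) (h1 : cB₂ * η * √(rate s p n) ≤ 1) :
    Tendsto (bound cB₁ cB₂ η Linf s p n) atTop (𝓝 Linf) := by
  have h2 : Tendsto (fun t : ℕ => (1 - cB₂ * η * √(rate s p n)) ^ t) atTop (𝓝 0) :=
    tendsto_pow_atTop_nhds_zero_of_lt_one (by linarith) (by linarith)
  have h3 := (h2.mul_const (initBound cB₁ s - Linf)).const_add Linf
  rw [zero_mul, add_zero] at h3
  exact h3

/-- The bounds tend to L_∞ ≤ ℓ, so the set is bounded above and its supremum is not the default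
value 0. -/
lemma le_lastIter {M γ c₀ ℓ : ℝ} (h0 : 0 < cB₂ * η * √(rate s p n))
    (h1 : cB₂ * η * √(rate s p n) ≤ 1) (hL : Linf ≤ ℓ) {t : ℕ}
    (hpos : 0 < 4 * cB₂ * (1 + cB₁) / ((1 - c₀) * γ ^ 2 / M) * √((s : ℝ) ^ 2 * Real.log p / n))
    (ht : 4 * cB₂ * (1 + cB₁) / ((1 - c₀) * γ ^ 2 / M) * √((s : ℝ) ^ 2 * Real.log p / n) ≤
      bound cB₁ cB₂ η Linf s p n t - ℓ) :
    t ≤ lastIter M γ c₀ cB₁ cB₂ η Linf ℓ s p n := by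
  refine le_csSup ?_ ht
  have h2 : ∀ᶠ t in atTop, bound cB₁ cB₂ η Linf s p n t < ℓ +
      4 * cB₂ * (1 + cB₁) / ((1 - c₀) * γ ^ 2 / M) * √((s : ℝ) ^ 2 * Real.log p / n) :=
    (tendsto_bound h0 h1).eventually_lt_const (by linarith)
  obtain ⟨N, hN⟩ := eventually_atTop.1 h2
  refine ⟨N, fun t ht => ?_⟩
  by_contra hc
  have h3 := hN t (by omega)
  rw [Set.mem_ofPred_eq] at ht
  linarith

end Bounds

/-! ### The sign of the leading direction. -/

section Signs

variable {p : ℕ} {S L Sh Lh : Matrix (Fin p) (Fin p) ℝ} {x b : Vec p}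

lemma norm_sub_sq_eq (hb : ‖b‖ = 1) (hx : ‖x‖ = 1) : ‖b - x‖ ^ 2 = 2 * (1 - inner ℝ b x) := by
  rw [norm_sub_sq_real, hb, hx]
  ring

/-- Up to a sign of `x`, the discrepancy is half the squared distance. -/
lemma exists_sign (hb : ‖b‖ = 1) (hx : ‖x‖ = 1) : ∃ z : Vec p, (z = x ∨ z = -x) ∧
    ‖b - z‖ ^ 2 = 2 * discrepancy x b ∧ ‖b - z‖ ^ 2 ≤ 2 := by
  rcases le_total 0 (inner ℝ b x) with h | h
  · refine ⟨x, Or.inl rfl, ?_, ?_⟩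
    · rw [norm_sub_sq_eq hb hx, discrepancy, abs_of_nonneg h]
    · rw [norm_sub_sq_eq hb hx]
      linarith
  · have hx' : ‖-x‖ = 1 := by rwa [norm_neg]
    refine ⟨-x, Or.inr rfl, ?_, ?_⟩
    · rw [norm_sub_sq_eq hb hx', discrepancy, abs_of_nonpos h, inner_neg_right]
    · rw [norm_sub_sq_eq hb hx', inner_neg_right]
      linarith

lemma rayleigh_neg : rayleigh S L (-b) = rayleigh S L b := by
  simp [rayleigh, quad_eq_bil]

end Signs

/-! ### The deterministic theorem. -/

lemma sqrt_rate_eq (s p n : ℕ) : √(rate s p n) = √(s : ℝ) * √(Real.log p / n) := by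
  rw [rate, mul_div_assoc, Real.sqrt_mul (Nat.cast_nonneg _)]

lemma sqrt_sq_mul_eq (s p n : ℕ) :
    √((s : ℝ) ^ 2 * Real.log p / n) = √(s : ℝ) * √(rate s p n) := by
  rw [← Real.sqrt_mul (Nat.cast_nonneg _), rate]
  congr 1
  ring

lemma IsPopulation.constants {p D : ℕ} {blk : Fin p → Fin D} {S : Matrix (Fin p) (Fin p) ℝ}
    {ξ : ℕ → Vec p} {M γ C : ℝ} (h : IsPopulation blk S ξ M γ C) (hM : 0 < M) (hC : 0 < C) :
    1 ≤ M ∧ γ ≤ 1 := by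
  have hl := h.isLeading hM hC
  constructor
  · have h1 := hl.one_le
    have h2 := hl.upper (ξ 1)
    rw [hl.norm_eq] at h2
    by_contra hc
    nlinarith
  · have h1 : 0 ≤ corr blk S ξ 2 := by
      rw [corr, rayleigh, quad_eq_bil, quad_eq_bil]
      exact div_nonneg (hl.nonneg _) (hl.nonneg_right hM _)
    have h2 := h.gap
    have h3 := hl.pos
    by_contra hc
    nlinarith

set_option maxHeartbeats 1000000 in
/-- The deterministic part of the result: on the event that the sample covariance matrix is close
to the population one on the net, every selected iterate has the optimal rate. -/
lemma exists_deterministic_constants {M γ c₀ η cB₁ cB₂ : ℝ} (hM : 0 < M) (hγ : 0 < γ)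
    (hc₀ : 0 < c₀) (hc₀' : c₀ < 1) (hη : 0 < η) (hη' : η ≤ (1 - c₀) / (2 * M * (M + 3)))
    (hcB₁ : 0 < cB₁) (hcB₂ : 0 < cB₂) :
    ∃ ψ₁ : ℝ, 0 < ψ₁ ∧ ∀ c₂ : ℝ, 0 < c₂ → ∃ τ₀ : ℝ, 0 < τ₀ ∧ ∀ τ : ℝ, τ₀ ≤ τ →
      ∃ ψ₂ ε₀ : ℝ, 0 < ψ₂ ∧ 0 < ε₀ ∧
      ∀ {p D n s : ℕ} {blk : Fin p → Fin D} {S : Matrix (Fin p) (Fin p) ℝ} {ξ : ℕ → Vec p}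
        {C Linf : ℝ} {x : Fin n → Vec p} {b : ℕ → Vec p},
        0 < C → IsPopulation blk S ξ M γ C → s = l0 (ξ 1) → 0 < n → √(rate s p n) ≤ ε₀ →
        1 ≤ Linf → Linf ≤ l1 (ξ 1) →
        (∀ v ∈ net p (2 * (2 * s)) (2 * s),
          |bil (sampleCov x) v v - bil S v v| ≤ 11 * √(rate s p n) * bil S v v) →
        IsRun blk x η (bound cB₁ cB₂ η Linf s p n) b → b 0 ∈ feasible p (initBound cB₁ s) →
        discrepancy (ξ 1) (b 0) ≤ ψ₁ →
        ∀ N : ℕ∞, (lastIter M γ c₀ cB₁ cB₂ η Linf (l1 (ξ 1)) s p n : ℕ∞) ≤ N →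
        ∀ t : ℕ, (t : ℕ∞) ≤ N →
        (∀ t' : ℕ, (t' : ℕ∞) ≤ N →
          penalized blk x τ (corr blk S ξ 1) c₂ (initBound cB₁ s) (b t') ≤
            penalized blk x τ (corr blk S ξ 1) c₂ (initBound cB₁ s) (b t)) →
        discrepancy (ξ 1) (b t) ≤ ψ₂ * rate s p n := by
  -- Otherwise there is no population at all and any constants will do.
  by_cases hMγ : 1 ≤ M ∧ γ ≤ 1
  swap
  · refine ⟨1, one_pos, fun _ _ => ⟨1, one_pos, fun _ _ => ⟨1, 1, one_pos, one_pos, ?_⟩⟩⟩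
    intro p D n s blk S ξ C Linf x b hC hpop
    exact absurd (hpop.constants hM hC) hMγ
  obtain ⟨hM1, hγ1⟩ := hMγ
  have hden : 0 < 2 * M * (M + 3) := by positivity
  rw [le_div_iff₀ hden] at hη'
  have hηM : η * M ≤ 1 := by
    have : 0 < η * M := by positivity
    nlinarith
  have hκ1 : η * γ / (2 * M) ≤ 1 := by
    rw [div_le_one (by positivity)]
    nlinarith
  obtain ⟨A, hA⟩ : ∃ A, A = 1 + cB₁ := ⟨_, rfl⟩
  have hA1 : 1 ≤ A := by linarith
  have hA0 : 0 < A := by linarith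
  -- The noise level is e = K ε with ε = √(s ln p / n): `isClose_of_net` multiplies the deviation 11
  -- ε on the net by 4 M.
  obtain ⟨K, hK⟩ : ∃ K, K = 44 * M := ⟨_, rfl⟩
  have hK0 : 0 < K := by rw [hK]; positivity
  obtain ⟨thr, hthr⟩ : ∃ thr, thr = 4 * cB₂ * (1 + cB₁) / ((1 - c₀) * γ ^ 2 / M) := ⟨_, rfl⟩
  have hthr0 : 0 < thr := by
    have : 0 < 1 - c₀ := by linarith
    rw [hthr]
    positivity
  obtain ⟨c, hc, hrun⟩ := exists_run_constants hM hγ hη hηM hκ1 hA1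
  obtain ⟨μ, hμ⟩ : ∃ μ, μ = cB₂ * η * A / K := ⟨_, rfl⟩
  have hμ0 : 0 < μ := by rw [hμ]; positivity
  -- K₁ ≥ thr / K makes a slack of K₁ e large enough for the inequality defining T*; μ e bounds the
  -- drop of the normalized slack in one step.
  obtain ⟨K₁, e₁, hK₁, hK₁0, he₁, hrun⟩ := hrun μ (thr / K)
  obtain ⟨τ₀, e₂, hτ₀, he₂, hpen⟩ := exists_penalized_constants hM hγ hA1
  -- The initial slack is y 0 ≥ cB₁ since ‖ξ₁‖₁ ≤ √s, and the squared distance is 2δ, so this ψ₁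
  -- starts the induction. The factor K in `τ₀ * K` converts √(s ln p / n) into the noise level e.
  refine ⟨c * cB₁ ^ 2 / 2, by positivity, fun c₂ hc₂ => ⟨τ₀ * K, by positivity, fun τ hτ => ?_⟩⟩
  obtain ⟨a, ha⟩ : ∃ a, a = √c * (K₁ + μ) + (K₁ + μ) := ⟨_, rfl⟩
  have ha0 : 0 < a := by rw [ha]; positivity
  obtain ⟨Kf, hKf, hpen⟩ := hpen (τ / K) c₂ a (by rwa [le_div_iff₀ hK0]) hc₂ ha0
  obtain ⟨ε₀, hε1, hε2, hε3, hε4, hε0⟩ : ∃ ε₀ : ℝ, K * ε₀ ≤ e₁ ∧ K * ε₀ ≤ e₂ ∧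
      cB₂ * η * ε₀ ≤ 1 ∧ K₁ * K * ε₀ ≤ cB₁ ∧ 0 < ε₀ := by
    obtain ⟨ε, ⟨⟨⟨⟨h1, h2⟩, h3⟩, h4⟩, h5⟩⟩ := ((((eventually_mul_le K he₁).and
      (eventually_mul_le K he₂)).and (eventually_mul_le (cB₂ * η) one_pos)).and
      (eventually_mul_le (K₁ * K) hcB₁)).and self_mem_nhdsWithin |>.exists
    exact ⟨ε, h1, h2, h3, h4, h5⟩
  refine ⟨Kf * K ^ 2 / 2, ε₀, by positivity, hε0, ?_⟩
  intro p D n s blk S ξ C Linf x b hC hpop hs hn hεle hL1 hLl hnet hIsRun hb0 hδ N hN t htN hmax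
  have hlead := hpop.isLeading hM hC
  have hp2 := hpop.two_le hC
  set y₀ := ξ 1 with hy₀
  set r := corr blk S ξ 1 with hr
  have hs0 : 0 < s := hs ▸ l0_pos hlead.norm_eq
  have hsR : (0 : ℝ) < s := by exact_mod_cast hs0
  have hsq : 0 < √(s : ℝ) := Real.sqrt_pos.2 hsR
  have hnR : (0 : ℝ) < n := by exact_mod_cast hn
  have hlog : 0 < Real.log p := Real.log_pos (by exact_mod_cast hp2)
  have hrate : 0 < rate s p n := by unfold rate; positivity
  set ε := √(rate s p n) with hε
  have hεpos : 0 < ε := Real.sqrt_pos.2 hrate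
  have hclose : IsClose S (blockPart blk S) (sampleCov x) (blockPart blk (sampleCov x)) s r
      (K * ε) := by
    have := isClose_of_net (blk := blk) hlead.symm_left (isSymm_sampleCov x) hs0 (by omega)
      (by positivity) hlead.pos.le hM.le hnet (hlead.le_norm hM hγ.le) hlead.upper
    have he : 4 * M * (11 * ε) = K * ε := by rw [hK]; ring
    rwa [he] at this
  have hxl : l1 y₀ ≤ √(s : ℝ) := by
    rw [hs]
    simpa [hlead.norm_eq] using l1_le_sqrt_l0 y₀
  have hstart : initBound cB₁ s = A * √(s : ℝ) := by rw [initBound, hA]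
  have ha0' : 0 < cB₂ * η * ε := by positivity
  have ha1' : cB₂ * η * ε ≤ 1 := le_trans (by gcongr) hε3
  have hLinit : Linf ≤ initBound cB₁ s := by
    rw [hstart]
    have : 1 * √(s : ℝ) ≤ A * √(s : ℝ) := by gcongr
    linarith
  set ℓ := bound cB₁ cB₂ η Linf s p n with hℓ
  have hℓ0 : ℓ 0 = initBound cB₁ s := bound_zero
  have hℓA : ∀ t, ℓ t ≤ A * √(s : ℝ) := by
    intro t
    rw [← hstart]
    exact bound_le ha0'.le ha1' hLinit t
  set y : ℕ → ℝ := fun t => (ℓ t - l1 y₀) / √(s : ℝ) with hy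
  have hdrop : ∀ t, y t ≤ y (t + 1) + μ * (K * ε) := by
    intro t
    have h1 := bound_le_succ_add ha0'.le ha1' (by linarith) hLinit t
    rw [← hℓ, hstart] at h1
    have h2 : μ * (K * ε) = cB₂ * η * ε * A := by rw [hμ]; field_simp
    simp only [hy]
    rw [h2, div_add' _ _ _ hsq.ne']
    gcongr
    linarith
  -- the first iteration after which the slack falls below the noise level
  have hex : ∃ t, y (t + 1) < K₁ * (K * ε) := by
    have h1 : Tendsto y atTop (𝓝 ((Linf - l1 y₀) / √(s : ℝ))) :=
      ((tendsto_bound ha0' ha1').sub_const _).div_const _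
    have h2 : (Linf - l1 y₀) / √(s : ℝ) < K₁ * (K * ε) :=
      lt_of_le_of_lt (div_nonpos_of_nonpos_of_nonneg (by linarith) hsq.le) (by positivity)
    have h3 := ((tendsto_add_atTop_iff_nat 1).2 h1).eventually_lt_const h2
    exact h3.exists
  classical
  set T := Nat.find hex with hT
  have hyT1 : y (T + 1) < K₁ * (K * ε) := Nat.find_spec hex
  have hy0 : cB₁ ≤ y 0 := by
    simp only [hy, hℓ0, hstart]
    rw [le_div_iff₀ hsq, hA]
    linarith
  -- Minimality of `T` concerns the indices i + 1; index 0 is covered by the initial slack.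
  have hybig : ∀ i ≤ T, K₁ * (K * ε) ≤ y i := by
    intro i hi
    cases i with
    | zero =>
      refine le_trans ?_ hy0
      refine le_trans ?_ hε4
      rw [mul_assoc]
      gcongr
    | succ i => exact not_lt.1 (Nat.find_min hex hi)
  have hyT : y T ≤ (K₁ + μ) * (K * ε) := by linarith [hdrop T]
  have hyT0 : 0 ≤ y T := le_trans (by positivity) (hybig T le_rfl)
  have hTle : T ≤ lastIter M γ c₀ cB₁ cB₂ η Linf (l1 y₀) s p n := by
    have h1 : thr * (√(s : ℝ) * ε) ≤ ℓ T - l1 y₀ := by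
      have h2 : thr * ε ≤ y T := by
        refine le_trans ?_ (hybig T le_rfl)
        rw [div_le_iff₀ hK0] at hK₁
        rw [← mul_assoc]
        gcongr
      have h3 : y T * √(s : ℝ) = ℓ T - l1 y₀ := div_mul_cancel₀ _ hsq.ne'
      rw [← h3]
      calc thr * (√(s : ℝ) * ε) = thr * ε * √(s : ℝ) := by ring
        _ ≤ _ := by gcongr
    refine le_lastIter ha0' ha1' hLl ?_ ?_
    · rw [← hthr, sqrt_sq_mul_eq]
      positivity
    · rw [← hthr, sqrt_sq_mul_eq]
      exact h1
  -- the iterates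
  have hfeas : ∀ t, b t ∈ feasible p (ℓ t) := by
    intro t
    cases t with
    | zero => rw [hℓ0]; exact hb0
    | succ t => exact (hIsRun t).1
  have hgrad : ∀ t, b (t + 1) ∈ feasible p (ℓ (t + 1)) ∧ ∀ v ∈ feasible p (ℓ (t + 1)),
      inner ℝ v (gradStep (sampleCov x) (blockPart blk (sampleCov x)) η (b t)) ≤
        inner ℝ (b (t + 1)) (gradStep (sampleCov x) (blockPart blk (sampleCov x)) η (b t)) :=
    fun t => ⟨(hIsRun t).1, fun v hv => le_of_isNearest (hIsRun t).1.1 hv.1 ((hIsRun t).2 v hv)⟩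
  have hflip : ∀ z : Vec p, z = y₀ ∨ z = -y₀ →
      IsLeading S (blockPart blk S) z r M γ ∧ s = l0 z ∧ l1 z = l1 y₀ := by
    rintro z (rfl | rfl)
    · exact ⟨hlead, hs, rfl⟩
    · exact ⟨hlead.neg, by rw [l0_neg, hs], l1_neg _⟩
  obtain ⟨z, hz, hz0, -⟩ := exists_sign (hfeas 0).1 hlead.norm_eq
  obtain ⟨hlz, hsz, hl1z⟩ := hflip z hz
  have hinv : ‖b T - z‖ ^ 2 ≤ c * y T ^ 2 := by
    refine hrun hlz hsz hclose (by positivity) (le_trans (by gcongr) hε1) b ℓ y (hfeas 0) hgrad hℓA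
      (fun t => by rw [hl1z]) hdrop ?_ T hybig
    rw [hz0]
    have : cB₁ ^ 2 ≤ y 0 ^ 2 := by gcongr
    have := mul_le_mul_of_nonneg_left this hc.le
    linarith
  have hTnorm : ‖b T - z‖ ≤ a * (K * ε) := by
    have h1 : ‖b T - z‖ ≤ √c * ((K₁ + μ) * (K * ε)) := by
      apply le_of_sq_le_sq _ (by positivity)
      rw [mul_pow, Real.sq_sqrt hc.le]
      exact hinv.trans (by gcongr)
    have h2 : 0 ≤ (K₁ + μ) * (K * ε) := by positivity
    rw [ha]
    linarith
  have hTl1 : (l1 (b T) - l1 y₀) / √(s : ℝ) ≤ a * (K * ε) := by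
    have h1 : (l1 (b T) - l1 y₀) / √(s : ℝ) ≤ y T := by
      simp only [hy]
      gcongr
      exact (hfeas T).2
    have h2 : 0 ≤ √c * (K₁ + μ) * (K * ε) := by positivity
    rw [ha]
    linarith
  -- comparison of the selected iterate with the iterate `T`
  have hcmp := hmax T ((Nat.cast_le.2 hTle).trans hN)
  have hpeneq : ∀ u : Vec p, penalized blk x τ r c₂ (initBound cB₁ s) u =
      rayleigh (sampleCov x) (blockPart blk (sampleCov x)) u -
        r * (τ / K * (K * ε) * (l1 u / √(s : ℝ) + c₂ * (l1 u / √(s : ℝ)) ^ 2 / A)) := by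
    intro u
    rw [penalized, objective, hstart, hε, sqrt_rate_eq]
    congr 1
    field_simp
  rw [hpeneq, hpeneq] at hcmp
  obtain ⟨z', hz', hz'0, hz'2⟩ := exists_sign (hfeas t).1 hlead.norm_eq
  obtain ⟨hlz', hsz', hl1z'⟩ := hflip z' hz'
  -- The selected iterate may be closer to the opposite sign of ξ₁ than the iterate `T`. The
  -- objective and the ℓ₁ norm are even, so `b T` may be reflected.
  obtain ⟨w, hw, hwz⟩ : ∃ w, (w = b T ∨ w = -b T) ∧ ‖w - z'‖ ≤ a * (K * ε) := by
    have hcase : z' = z ∨ z' = -z := by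
      rcases hz with rfl | rfl <;> rcases hz' with rfl | rfl <;> simp
    rcases hcase with rfl | rfl
    · exact ⟨b T, Or.inl rfl, hTnorm⟩
    · refine ⟨-b T, Or.inr rfl, ?_⟩
      rwa [neg_sub_neg, norm_sub_rev]
  obtain ⟨hw1, hwl, hwr⟩ : ‖w‖ = 1 ∧ l1 w = l1 (b T) ∧
      rayleigh (sampleCov x) (blockPart blk (sampleCov x)) w =
        rayleigh (sampleCov x) (blockPart blk (sampleCov x)) (b T) := by
    rcases hw with rfl | rfl
    · exact ⟨(hfeas T).1, rfl, rfl⟩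
    · exact ⟨by rw [norm_neg, (hfeas T).1], l1_neg _, rayleigh_neg⟩
  have hfin := hpen hlz' hsz' hclose (by positivity) (le_trans (by gcongr) hε2) (b t) w (hfeas t).1
    hw1 ((hfeas t).2.trans (hℓA t)) (by rw [hwl]; exact (hfeas T).2.trans (hℓA T)) hz'2 hwz
    (by rw [hwl, hl1z']; exact hTl1) (by rw [hwl, hwr]; exact hcmp)
  rw [hz'0, mul_pow, hε, Real.sq_sqrt hrate.le] at hfin
  linarith

end

end MsCCA

/-! ### The probabilistic conclusion. -/

theorem theorem2
    (M γ c₀ η cB₁ cB₂ : ℝ) (hM : 0 < M) (hγ : 0 < γ) (hc₀ : 0 < c₀) (hc₀' : c₀ < 1)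
    (hη : 0 < η) (hη' : η ≤ (1 - c₀) / (2 * M * (M + 3))) (hcB₁ : 0 < cB₁) (hcB₂ : 0 < cB₂) :
    ∃ ψ₁ : ℝ, 0 < ψ₁ ∧ ∀ c₂ : ℝ, 0 < c₂ → ∃ τ₀ : ℝ, 0 < τ₀ ∧ ∀ τ : ℝ, τ₀ ≤ τ →
      ∃ ψ₂ : ℝ, 0 < ψ₂ ∧
      -- the population model for each sample size `n`
      ∀ (p D s : ℕ → ℕ) (blk : ∀ n, Fin (p n) → Fin (D n))
        (S : ∀ n, Matrix (Fin (p n)) (Fin (p n)) ℝ) (ξ : ∀ n, ℕ → MsCCA.Vec (p n))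
        (C : ℝ) (Linf : ℕ → ℝ),
        0 < C →
        Tendsto p atTop atTop →
        (∀ n, MsCCA.IsPopulation (blk n) (S n) (ξ n) M γ C) →
        (∀ n, s n = MsCCA.l0 (ξ n 1)) →
        Tendsto (fun n => MsCCA.rate (s n) (p n) n) atTop (𝓝 0) →
        (∀ n, 1 ≤ Linf n ∧ Linf n ≤ MsCCA.l1 (ξ n 1)) →
      -- the data: `n` independent observations from `N(0, S n)`
      ∀ (Ω : ℕ → Type*) [∀ n, MeasurableSpace (Ω n)] (P : ∀ n, Measure (Ω n))
        [∀ n, IsProbabilityMeasure (P n)] (X : ∀ n, Fin n → Ω n → MsCCA.Vec (p n)),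
        (∀ n i, HasLaw (X n i) (multivariateGaussian 0 (S n)) (P n)) →
        (∀ n, iIndepFun (X n) (P n)) →
      -- the iterates, with a possibly data-dependent initial guess
      ∀ β : ∀ n, ℕ → Ω n → MsCCA.Vec (p n),
        (∀ n t, Measurable (β n t)) →
        (∀ᶠ n in atTop, ∀ ω, MsCCA.IsRun (blk n) (fun i => X n i ω) η
          (MsCCA.bound cB₁ cB₂ η (Linf n) (s n) (p n) n) (fun t => β n t ω)) →
        Tendsto (fun n => P n {ω | β n 0 ω ∈ MsCCA.feasible (p n) (MsCCA.initBound cB₁ (s n)) ∧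
          MsCCA.discrepancy (ξ n 1) (β n 0 ω) ≤ ψ₁}) atTop (𝓝 1) →
      -- every maximizer of the penalized objective over the iterations `0, …, N`, for every
      -- `N ≥ T*`, and over all iterations (`N = ⊤`), has the optimal rate
      Tendsto (fun n => P n {ω | ∀ N : ℕ∞,
          (MsCCA.lastIter M γ c₀ cB₁ cB₂ η (Linf n) (MsCCA.l1 (ξ n 1)) (s n) (p n) n : ℕ∞) ≤ N →
          ∀ t : ℕ, (t : ℕ∞) ≤ N →
          (∀ t' : ℕ, (t' : ℕ∞) ≤ N →
            MsCCA.penalized (blk n) (fun i => X n i ω) τ (MsCCA.corr (blk n) (S n) (ξ n) 1) c₂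
              (MsCCA.initBound cB₁ (s n)) (β n t' ω) ≤
            MsCCA.penalized (blk n) (fun i => X n i ω) τ (MsCCA.corr (blk n) (S n) (ξ n) 1) c₂
              (MsCCA.initBound cB₁ (s n)) (β n t ω)) →
          MsCCA.discrepancy (ξ n 1) (β n t ω) ≤ ψ₂ * MsCCA.rate (s n) (p n) n}) atTop (𝓝 1) := by
  obtain ⟨ψ₁, hψ₁, hdet⟩ :=
    MsCCA.exists_deterministic_constants hM hγ hc₀ hc₀' hη hη' hcB₁ hcB₂
  refine ⟨ψ₁, hψ₁, fun c₂ hc₂ => ?_⟩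
  obtain ⟨τ₀, hτ₀, hdet⟩ := hdet c₂ hc₂
  refine ⟨τ₀, hτ₀, fun τ hτ => ?_⟩
  obtain ⟨ψ₂, ε₀, hψ₂, hε₀, hdet⟩ := hdet τ hτ
  refine ⟨ψ₂, hψ₂, ?_⟩
  intro p D s blk S ξ C Linf hC hp hpop hs hrate hLinf Ω _ P _ X hX hind β _ hrun hstart
  have hsqrt : Tendsto (fun n => √(MsCCA.rate (s n) (p n) n)) atTop (𝓝 0) := by
    simpa using hrate.sqrt
  have hp' : Tendsto (fun n => ENNReal.ofReal (2 / (p n : ℝ))) atTop (𝓝 0) := by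
    rw [← ENNReal.ofReal_zero]
    exact ENNReal.tendsto_ofReal
      (tendsto_const_nhds.div_atTop (tendsto_natCast_atTop_atTop.comp hp))
  have hlow := ENNReal.Tendsto.sub hstart hp' (Or.inl ENNReal.one_ne_top)
  rw [tsub_zero] at hlow
  refine tendsto_of_tendsto_of_tendsto_of_le_of_le' hlow tendsto_const_nhds ?_
    (Eventually.of_forall fun n => prob_le_one)
  filter_upwards [hrun, hsqrt.eventually_le_const hε₀,
    hsqrt.eventually_le_const (show (0 : ℝ) < 1 / 11 by norm_num), eventually_gt_atTop 0]
    with n hrun hε hε' hn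
  have hlead := (hpop n).isLeading hM hC
  have hs0 : 0 < s n := hs n ▸ MsCCA.l0_pos hlead.norm_eq
  have hsp : s n ≤ p n := by
    rw [hs n, MsCCA.l0]
    exact (Finset.card_le_univ _).trans (by simp)
  have hbad := MsCCA.measure_net_deviation_le hn (hpop n).posSemidef (hX n) (hind n) hs0 hsp
    ((hpop n).two_le hC) (by linarith)
  rw [measureReal_def,
    ← ENNReal.le_ofReal_iff_toReal_le (measure_ne_top _ _) (by positivity)] at hbad
  -- The event of a good start lies in the union of the desired event and the deviation event, so
  -- monotonicity and subadditivity of the measure suffice, without measurability of either.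
  rw [tsub_le_iff_right]
  refine le_trans ?_ (add_le_add le_rfl hbad)
  refine le_trans (measure_mono ?_) (measure_union_le _ _)
  rintro ω ⟨hω0, hωδ⟩
  by_cases hnet : ∀ v ∈ MsCCA.net (p n) (2 * (2 * s n)) (2 * s n),
      |MsCCA.bil (MsCCA.sampleCov fun i => X n i ω) v v - MsCCA.bil (S n) v v| ≤
        11 * √(MsCCA.rate (s n) (p n) n) * MsCCA.bil (S n) v v
  · left
    exact hdet hC (hpop n) (hs n) hn hε (hLinf n).1 (hLinf n).2 hnet (hrun ω) hω0 hωδ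
  · right
    exact hnet
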